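/- **Conventions.** Let $\Omega=[0,1]$, with basic open sets the traces on $[0,1]$ of open intervals with rational endpoints; let $\mathcal X=2^{\mathbb N}$, with basic open sets the cylinders $[\sigma]$ for finite binary strings $\sigma$; and let $\Omega\times\mathcal X$ have as basic open sets the products of these. In each space a *c.e. open* set is the union of the basic open sets whose indices lie in a c.e. set, and an *effectively closed* set is the complement of a c.e. open set. A *computable sequence* of such sets is one for which this is uniform in the index. A probability measure $\nu$ is *computable* if $\nu(U)$ is left-c.e., uniformly in the c.e. open set $U$. A point is *Kurtz $\nu$-random* (in $\mathsf{KR}^\nu$) if it lies in every c.e. open $U$ with $\nu(U)=1$. It is *Schnorr $\nu$-random* (in $\mathsf{SR}^\nu$) if it lies outside $\bigcap_n U_n$ for every computable sequence of c.e. opens $U_n$ with $\nu(U_n)\le 2^{-n}$ and $\nu(U_n)$ uniformly computable. A *$\nu$-computable basis* is a computable sequence of c.e. opens $U_0,U_1,\dots$ with $\nu(U_i)$ uniformly computable, such that every c.e. open set is (uniformly) an effective union of them, and such that there is a computable sequence of effectively closed sets $C_i\supseteq U_i$ with $\nu(C_i)=\nu(U_i)$. Functions $f_n$ are *uniformly computable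 continuous* if the inverse images under $f_n$ of c.e. opens are c.e. open, uniformly in $n$ and in the c.e. open. **Proposition (limiting relative frequencies).** Let $p$ be a computable probability measure on $\Omega=[0,1]$, and let $C\subseteq\Omega$ be effectively closed with $p(C)=1$. For $\theta\in C$ let $p(\cdot\mid\theta)$ be the measure on $\mathcal X=2^{\mathbb N}$ that is the countable product of the measure on $\{0,1\}$ giving $1$ probability $\theta$; for $\theta\notin C$ let $p(\cdot\mid\theta)$ be the zero measure. Let $\mu$ be the joint distribution on $\Omega\times\mathcal X$, that is, $\mu(A\times B)=\int_A p(B\mid\theta)\,dp(\theta)$. Let $f_n(x)=\frac1n\sum_{i<n}x(i)$ for $n\geq 1$, and $f_0(x)=0$. Then the functions $f_n:\mathcal X\to\Omega$ are uniformly computable continuous, and: 1. There is a Borel set $D\subseteq\mathsf{KR}^p\times\mathcal X$ with $\mu(D)=1$ such that $\lim_n f_n(x)$ exists and equals $\theta$ for all $(\theta,x)\in D$. 2. There is a $p$-computable basis $(U_i)$ of $\Omega$ such that the sets $f_n^{-1}(U_i)$ are both c.e. open and effectively closed, uniformly in $n\ge 0$ and $i$. Moreover, for all $n\ge1$ and $\varepsilon>0$,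 $$\mu\big(\{(\theta,x):|f_n(x)-\theta|>\varepsilon\}\big)\le\frac{1}{\varepsilon^{2}n}\Big(\int_\Omega\theta\,dp(\theta)-\int_\Omega\theta^2\,dp(\theta)\Big),$$ and $\lim_n f_n(x)=\theta$ for every $(\theta,x)\in\mathsf{SR}^\mu$. -/

import Mathlib

open MeasureTheory ProbabilityTheory Filter Topology
open scoped ENNReal

noncomputable section

namespace EffDoob

/-! ### Computability of families of real numbers -/

/-- A family of real numbers is uniformly computable if, from an index `i` and a precision `n`, one
can compute a dyadic rational within `2⁻ⁿ` of the `i`-th number. -/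
def UniformlyComputable {ι : Type*} [Primcodable ι] (r : ι → ℝ) : Prop :=
  ∃ a : ι → ℕ → ℤ, Computable₂ a ∧ ∀ i n, |r i - (a i n : ℝ) / 2 ^ n| ≤ 1 / 2 ^ n

/-- A family of nonnegative extended reals is uniformly left-c.e. if the set of pairs of an index
and a nonnegative rational `a / (d + 1)` strictly below the corresponding number is c.e. -/
def UniformlyLeftCE {ι : Type*} [Primcodable ι] (r : ι → ℝ≥0∞) : Prop :=
  REPred fun q : ι × ℕ × ℕ => (q.2.1 : ℝ≥0∞) / ((q.2.2 : ℝ≥0∞) + 1) < r q.1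

/-! ### C.e. open and effectively closed sets

`B : κ → Set Y` enumerates the basic open sets of the space `Y`. -/

section General

variable {ι κ κ' Y Z : Type*} [Primcodable ι] [Primcodable κ] [Primcodable κ']

/-- A computable sequence (indexed by `ι`) of c.e. open sets: each member is the union of the basic
open sets whose indices lie in a c.e. set, uniformly in the index. -/
def UniformlyCEOpen (B : κ → Set Y) (U : ι → Set Y) : Prop :=
  ∃ W : ι → κ → Prop, (REPred fun q : ι × κ => W q.1 q.2) ∧ ∀ i, U i = ⋃ (k) (_ : W i k), B k

/-- A computable sequence of effectively closed sets. -/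
def UniformlyEffClosed (B : κ → Set Y) (C : ι → Set Y) : Prop :=
  UniformlyCEOpen B fun i => (C i)ᶜ

def CEOpen (B : κ → Set Y) (U : Set Y) : Prop :=
  UniformlyCEOpen B fun _ : Unit => U

def EffClosed (B : κ → Set Y) (C : Set Y) : Prop :=
  CEOpen B Cᶜ

/-- The functions `f n : Y → Z` are uniformly computable continuous: inverse images of c.e. opens
are c.e. open, uniformly in `n` and in the c.e. open. -/
def UniformlyComputableContinuous (B : κ → Set Y) (B' : κ' → Set Z) (f : ℕ → Y → Z) : Prop :=
  ∀ V : ℕ → Set Z, UniformlyCEOpen B' V →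
    UniformlyCEOpen B fun q : ℕ × ℕ => f q.1 ⁻¹' V q.2

/-! ### Computable measures, computable bases and randomness -/

variable [MeasurableSpace Y]

/-- The measure `ν` is computable: `ν U` is left-c.e. uniformly in the c.e. open `U`. (Uniformity is
expressed through all computable sequences of c.e. opens; among these is the one that enumerates
all c.e. opens by their indices.) -/
def IsComputableMeasure (B : κ → Set Y) (ν : Measure Y) : Prop :=
  ∀ U : ℕ → Set Y, UniformlyCEOpen B U → UniformlyLeftCE fun n => ν (U n)

/-- `U` is a `ν`-computable basis. -/
structure IsComputableBasis (B : κ → Set Y) (ν : Measure Y) (U : ℕ → Set Y) : Prop where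
  ceOpen : UniformlyCEOpen B U
  /-- every c.e. open is, uniformly, an effective union of members of `U` -/
  generates : ∀ V : ℕ → Set Y, UniformlyCEOpen B V → UniformlyCEOpen U V
  computable : UniformlyComputable fun i => ν.real (U i)
  paired : ∃ C : ℕ → Set Y, UniformlyEffClosed B C ∧ ∀ i, U i ⊆ C i ∧ ν (C i) = ν (U i)

/-- The set of Kurtz `ν`-random points. -/
def kurtzRandom (B : κ → Set Y) (ν : Measure Y) : Set Y :=
  {y | ∀ U : Set Y, CEOpen B U → ν U = 1 → y ∈ U}

/-- The set of Schnorr `ν`-random points. -/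
def schnorrRandom (B : κ → Set Y) (ν : Measure Y) : Set Y :=
  {y | ∀ U : ℕ → Set Y, UniformlyCEOpen B U → (∀ n, ν (U n) ≤ (2⁻¹ : ℝ≥0∞) ^ n) →
    UniformlyComputable (fun n => ν.real (U n)) → y ∉ ⋂ n, U n}

end General

/-! ### The unit interval, Cantor space and their product -/

/-- Cantor space. -/
abbrev Cantor : Type := ℕ → Bool

/-- The traces on `[0,1]` of the open intervals with rational endpoints; the left endpoint
`(a - 1) / (d + 1)` may be negative, so that the half-open intervals `[0, q)` are included. -/
def intervalBasis (k : ℕ × ℕ × ℕ) : Set unitInterval :=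
  {θ | ((k.1 : ℝ) - 1) / ((k.2.2 : ℝ) + 1) < (θ : ℝ) ∧
    (θ : ℝ) < (k.2.1 : ℝ) / ((k.2.2 : ℝ) + 1)}

/-- The basic clopen set `[σ]` of all sequences that extend the string `σ`. -/
def cylinderBasis (σ : List Bool) : Set Cantor :=
  {x | ∀ (i : ℕ) (h : i < σ.length), x i = σ[i]}

def productBasis (k : (ℕ × ℕ × ℕ) × List Bool) : Set (unitInterval × Cantor) :=
  intervalBasis k.1 ×ˢ cylinderBasis k.2

theorem isOpen_intervalBasis (k : ℕ × ℕ × ℕ) : IsOpen (intervalBasis k) :=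
  (isOpen_lt continuous_const continuous_subtype_val).inter
    (isOpen_lt continuous_subtype_val continuous_const)

theorem EffClosed.measurableSet {C : Set unitInterval} (hC : EffClosed intervalBasis C) :
    MeasurableSet C := by
  obtain ⟨W, -, hW⟩ := hC
  have h : IsOpen Cᶜ := by
    rw [show Cᶜ = _ from hW ()]
    exact isOpen_iUnion fun k => isOpen_iUnion fun _ => isOpen_intervalBasis k
  exact (isOpen_compl_iff.1 h).measurableSet

/-! ### Likelihood, joint distribution and relative frequencies -/

/-- The measure on Cantor space that is the countable product of the measure on `{0,1}` which gives
`1` the probability `θ`. -/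
def bernoulliProduct (θ : unitInterval) : Measure Cantor :=
  Measure.infinitePi fun _ : ℕ => bernoulliMeasure true false θ

instance (θ : unitInterval) : IsProbabilityMeasure (bernoulliProduct θ) := by
  unfold bernoulliProduct
  infer_instance

theorem measurable_bernoulliProduct : Measurable bernoulliProduct := by
  refine Measurable.measure_of_isPiSystem_of_isProbabilityMeasure
    (generateFrom_squareCylinders (α := fun _ : ℕ => Bool)).symm
    (isPiSystem_squareCylinders (fun _ => MeasurableSpace.isPiSystem_measurableSet)
      fun _ => by simp) ?_
  rintro S ⟨s, t, ht, rfl⟩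
  have ht' : ∀ i ∈ s, MeasurableSet (t i) := fun i _ => ht i (Set.mem_univ i)
  simp only [bernoulliProduct, Measure.infinitePi_pi _ ht']
  refine Finset.measurable_prod s fun i hi => ?_
  classical
  simp only [bernoulliMeasure_apply _ (ht' i hi)]
  split_ifs
  · exact measurable_const
  · exact (unitInterval.toNNReal_continuous.measurable).coe_nnreal_ennreal
  · exact ((unitInterval.toNNReal_continuous.comp
      unitInterval.continuous_symm).measurable).coe_nnreal_ennreal
  · exact measurable_const

/-- The map `θ ↦ bernoulliProduct θ` as a Markov kernel. -/
def bernoulliKernel : Kernel unitInterval Cantor := ⟨bernoulliProduct, measurable_bernoulliProduct⟩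

instance : IsMarkovKernel bernoulliKernel :=
  ⟨fun θ => inferInstanceAs (IsProbabilityMeasure (bernoulliProduct θ))⟩

open Classical in
/-- The likelihood: the Bernoulli product measure for `θ` in `C`, and the zero measure otherwise. -/
def likelihood (C : Set unitInterval) (hC : MeasurableSet C) : Kernel unitInterval Cantor :=
  Kernel.piecewise hC bernoulliKernel 0

instance (C : Set unitInterval) (hC : MeasurableSet C) : IsFiniteKernel (likelihood C hC) := by
  unfold likelihood
  infer_instance

/-- The joint distribution `μ(A × B) = ∫_A p(B | θ) dp(θ)` on the product of parameter space and
sample space. -/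
def joint (p : Measure unitInterval) (C : Set unitInterval) (hC : MeasurableSet C) : Measure (unitInterval × Cantor) :=
  p ⊗ₘ likelihood C hC

/-- The relative frequency of `1` among the first `n` bits (`0` for `n = 0`). -/
def relFreq (n : ℕ) (x : Cantor) : unitInterval :=
  ⟨(∑ i ∈ Finset.range n, if x i then (1 : ℝ) else 0) / n, by
    have h0 : (0 : ℝ) ≤ ∑ i ∈ Finset.range n, if x i then (1 : ℝ) else 0 :=
      Finset.sum_nonneg fun i _ => by split_ifs <;> norm_num
    have h1 : (∑ i ∈ Finset.range n, if x i then (1 : ℝ) else 0) ≤ n := by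
      calc (∑ i ∈ Finset.range n, if x i then (1 : ℝ) else 0)
          ≤ ∑ i ∈ Finset.range n, (1 : ℝ) :=
            Finset.sum_le_sum fun i _ => by split_ifs <;> norm_num
        _ = n := by simp
    exact ⟨div_nonneg h0 n.cast_nonneg, div_le_one_of_le₀ h1 n.cast_nonneg⟩⟩

end EffDoob

end

open EffDoob

/-! ### Computable functions on natural numbers -/

attribute [fun_prop] Computable
attribute [fun_prop] Computable.id Computable.const Computable.comp Computable.pair

namespace EffDoob

section Computability

variable {α β γ : Type*} [Primcodable α] [Primcodable β] [Primcodable γ]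

@[fun_prop]
theorem computable_fst {f : α → β × γ} (hf : Computable f) : Computable fun a => (f a).1 :=
  Computable.fst.comp hf

@[fun_prop]
theorem computable_snd {f : α → β × γ} (hf : Computable f) : Computable fun a => (f a).2 :=
  Computable.snd.comp hf

@[fun_prop]
theorem computable_add {f g : α → ℕ} (hf : Computable f) (hg : Computable g) :
    Computable fun a => f a + g a :=
  Primrec.nat_add.to_comp.comp hf hg

@[fun_prop]
theorem computable_sub {f g : α → ℕ} (hf : Computable f) (hg : Computable g) :
    Computable fun a => f a - g a :=
  Primrec.nat_sub.to_comp.comp hf hg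

@[fun_prop]
theorem computable_mul {f g : α → ℕ} (hf : Computable f) (hg : Computable g) :
    Computable fun a => f a * g a :=
  Primrec.nat_mul.to_comp.comp hf hg

@[fun_prop]
theorem computable_div {f g : α → ℕ} (hf : Computable f) (hg : Computable g) :
    Computable fun a => f a / g a :=
  Primrec.nat_div.to_comp.comp hf hg

@[fun_prop]
theorem computable_mod {f g : α → ℕ} (hf : Computable f) (hg : Computable g) :
    Computable fun a => f a % g a :=
  Primrec.nat_mod.to_comp.comp hf hg

@[fun_prop]
theorem computable_pow {f g : α → ℕ} (hf : Computable f) (hg : Computable g) :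
    Computable fun a => f a ^ g a :=
  (Primrec₂.unpaired'.1 Nat.Primrec.pow).to_comp.comp hf hg

@[fun_prop]
theorem computable_blt {f g : α → ℕ} (hf : Computable f) (hg : Computable g) :
    Computable fun a => Nat.blt (f a) (g a) :=
  (Primrec.nat_lt.decide.to_comp.comp hf hg).of_eq fun a => by
    rw [Bool.eq_iff_iff, decide_eq_true_eq, Nat.blt_eq]

@[fun_prop]
theorem computable_beq {f g : α → ℕ} (hf : Computable f) (hg : Computable g) :
    Computable fun a => Nat.beq (f a) (g a) :=
  ((Primrec.eq (α := ℕ)).decide.to_comp.comp hf hg).of_eq fun a => by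
    rw [Bool.eq_iff_iff, decide_eq_true_eq, Nat.beq_eq]

@[fun_prop]
theorem computable_and {f g : α → Bool} (hf : Computable f) (hg : Computable g) :
    Computable fun a => (f a && g a) :=
  Primrec.and.to_comp.comp hf hg

@[fun_prop]
theorem computable_or {f g : α → Bool} (hf : Computable f) (hg : Computable g) :
    Computable fun a => (f a || g a) :=
  Primrec.or.to_comp.comp hf hg

@[fun_prop]
theorem computable_not {f : α → Bool} (hf : Computable f) : Computable fun a => !f a :=
  Primrec.not.to_comp.comp hf

@[fun_prop]
theorem computable_cond {c : α → Bool} {f g : α → β} (hc : Computable c) (hf : Computable f)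
    (hg : Computable g) : Computable fun a => bif c a then f a else g a :=
  Computable.cond hc hf hg

@[fun_prop]
theorem computable_length {f : α → List β} (hf : Computable f) :
    Computable fun a => (f a).length :=
  Computable.list_length.comp hf

/-- Recursion with a computable step function and parameters. -/
theorem computable_rec {n : α → ℕ} {g : α → β} {h : α × ℕ × β → β} (hn : Computable n)
    (hg : Computable g) (hh : Computable h) :
    Computable fun a => (Nat.rec (g a) (fun k r => h (a, k, r)) (n a) : β) :=
  Computable.nat_rec (h := fun a q => h (a, q)) hn hg hh

theorem computable_sum {n : α → ℕ} {f : α × ℕ → ℕ} (hn : Computable n) (hf : Computable f) :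
    Computable fun a => ∑ k ∈ Finset.range (n a), f (a, k) := by
  refine (computable_rec (g := fun _ => 0) (h := fun q : α × ℕ × ℕ => q.2.2 + f (q.1, q.2.1))
    hn (by fun_prop) (by fun_prop)).of_eq fun a => ?_
  generalize n a = m
  induction m with
  | zero => simp
  | succ m ih => rw [Finset.sum_range_succ, ← ih]

theorem computable_factorial {n : α → ℕ} (hn : Computable n) :
    Computable fun a => (n a).factorial := by
  refine (computable_rec (g := fun _ => 1) (h := fun q : α × ℕ × ℕ => (q.2.1 + 1) * q.2.2)
    hn (by fun_prop) (by fun_prop)).of_eq fun a => ?_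
  generalize n a = m
  induction m with
  | zero => simp
  | succ m ih => rw [Nat.factorial_succ, ← ih]

/-- The number of ones among the first `n` terms of a sequence of bits. -/
def bitCount (x : ℕ → Bool) (n : ℕ) : ℕ := ∑ i ∈ Finset.range n, bif x i then 1 else 0

theorem computable_bitCount {n : α → ℕ} {f : α × ℕ → Bool} (hn : Computable n)
    (hf : Computable f) : Computable fun a => bitCount (fun i => f (a, i)) (n a) :=
  computable_sum (f := fun q => bif f q then 1 else 0) hn (by fun_prop)

theorem bitCount_pos_iff {x : ℕ → Bool} {n : ℕ} : 0 < bitCount x n ↔ ∃ i < n, x i = true := by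
  simp only [bitCount, Finset.sum_pos_iff, Finset.mem_range]
  refine exists_congr fun i => and_congr_right fun _ => ?_
  cases x i <;> simp

/-! ### Recursively enumerable predicates -/

theorem rePred_of_bool {b : α → Bool} (hb : Computable b) : REPred fun a => b a = true :=
  ComputablePred.to_re ⟨inferInstance, hb.of_eq fun a => by simp⟩

theorem _root_.REPred.comp {P : β → Prop} (hP : REPred P) {f : α → β} (hf : Computable f) :
    REPred fun a => P (f a) :=
  Partrec.comp hP hf

/-- A recursively enumerable predicate is the domain of a partial recursive function. -/
theorem _root_.REPred.exists_code {P : α → Prop} (hP : REPred P) :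
    ∃ c : Nat.Partrec.Code, ∀ a, P a ↔ (c.eval (Encodable.encode a)).Dom := by
  obtain ⟨c, hc⟩ := Nat.Partrec.Code.exists_code.1 hP
  refine ⟨c, fun a => ?_⟩
  rw [hc]
  simp [Part.assert]

theorem _root_.REPred.exists_computable {P : α → Prop} (hP : REPred P) :
    ∃ R : α × ℕ → Bool, Computable R ∧ ∀ a, P a ↔ ∃ s, R (a, s) = true := by
  obtain ⟨c, hc⟩ := REPred.exists_code hP
  refine ⟨fun q => (Nat.Partrec.Code.evaln q.2 c (Encodable.encode q.1)).isSome, ?_, fun a => ?_⟩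
  · exact (Primrec.option_isSome.to_comp).comp (Nat.Partrec.Code.primrec_evaln.to_comp.comp
      (((Computable.snd).pair (Computable.const c)).pair (Computable.encode.comp Computable.fst)))
  · rw [hc, Part.dom_iff_mem]
    simp only [Nat.Partrec.Code.evaln_complete, Option.isSome_iff_exists]
    exact ⟨fun ⟨y, k, h⟩ => ⟨k, y, h⟩, fun ⟨k, y, h⟩ => ⟨y, k, h⟩⟩

theorem rePred_of_exists_bool {R : α × ℕ → Bool} (hR : Computable R) :
    REPred fun a => ∃ s, R (a, s) = true := by
  have h : Partrec fun a => Nat.rfind fun s => Part.some (R (a, s)) :=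
    Partrec.rfind (p := fun a s => Part.some (R (a, s))) hR
  refine h.dom_re.of_eq fun a => ?_
  refine Nat.rfind_dom.trans ?_
  simp

theorem _root_.REPred.exists {P : α × β → Prop} (hP : REPred P) : REPred fun a => ∃ b, P (a, b) := by
  obtain ⟨R, hR, hPR⟩ := REPred.exists_computable hP
  have hS : Computable fun q : α × ℕ =>
      ((Encodable.decode (α := β) q.2.unpair.1).map fun b => R ((q.1, b), q.2.unpair.2)).getD false := by
    refine Computable.option_getD (Computable.option_map (g := fun q b => R ((q.1, b), q.2.unpair.2))
      (Computable.decode.comp (Computable.fst.comp (Computable.unpair.comp Computable.snd))) ?_)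
      (Computable.const _)
    exact hR.comp (((Computable.fst.comp Computable.fst).pair Computable.snd).pair
      (Computable.snd.comp (Computable.unpair.comp (Computable.snd.comp Computable.fst))))
  refine (rePred_of_exists_bool hS).of_eq fun a => ⟨?_, ?_⟩
  · rintro ⟨s, hs⟩
    cases hd : Encodable.decode (α := β) s.unpair.1 with
    | none => simp [hd] at hs
    | some b => exact ⟨b, (hPR _).2 ⟨_, by simpa [hd] using hs⟩⟩
  · rintro ⟨b, hb⟩
    obtain ⟨s, hs⟩ := (hPR _).1 hb
    exact ⟨Nat.pair (Encodable.encode b) s, by simpa using hs⟩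

theorem _root_.REPred.and {P Q : α → Prop} (hP : REPred P) (hQ : REPred Q) :
    REPred fun a => P a ∧ Q a := by
  have : Partrec fun a => (Part.assert (P a) fun _ => Part.some ()).bind
      fun _ => Part.assert (Q a) fun _ => Part.some () :=
    Partrec.bind hP (g := fun a _ => Part.assert (Q a) fun _ => Part.some ())
      (Partrec.comp hQ Computable.fst)
  exact this.dom_re.of_eq fun a => by simp [Part.assert]

theorem _root_.REPred.or {P Q : α → Prop} (hP : REPred P) (hQ : REPred Q) :
    REPred fun a => P a ∨ Q a := by
  obtain ⟨R, hR, hPR⟩ := REPred.exists_computable hP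
  obtain ⟨S, hS, hQS⟩ := REPred.exists_computable hQ
  refine (rePred_of_exists_bool (R := fun q => R q || S q) (by fun_prop)).of_eq fun a => ?_
  simp [hPR, hQS, exists_or]

/-- A total recursively enumerable relation contains the graph of a computable function. -/
theorem _root_.REPred.exists_choice {P : α × β → Prop} (hP : REPred P) (h : ∀ a, ∃ b, P (a, b)) :
    ∃ f : α → β, Computable f ∧ ∀ a, P (a, f a) := by
  obtain ⟨R, hR, hPR⟩ := REPred.exists_computable hP
  have hS : Computable₂ fun (a : α) (s : ℕ) => (Encodable.decode (α := β) s.unpair.1).bind fun b =>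
      bif R ((a, b), s.unpair.2) then some b else none := by
    refine Computable.option_bind (g := fun (q : α × ℕ) b =>
      bif R ((q.1, b), q.2.unpair.2) then some b else none)
      (Computable.decode.comp (Computable.fst.comp (Computable.unpair.comp Computable.snd))) ?_
    refine Computable.cond ?_ (Computable.option_some.comp Computable.snd) (Computable.const _)
    exact hR.comp (((Computable.fst.comp Computable.fst).pair Computable.snd).pair
      (Computable.snd.comp (Computable.unpair.comp (Computable.snd.comp Computable.fst))))
  have hdom : ∀ a, (Nat.rfindOpt fun s => (Encodable.decode (α := β) s.unpair.1).bind fun b =>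
      bif R ((a, b), s.unpair.2) then some b else none).Dom := by
    intro a
    rw [Nat.rfindOpt_dom]
    obtain ⟨b, hb⟩ := h a
    obtain ⟨s, hs⟩ := (hPR _).1 hb
    exact ⟨Nat.pair (Encodable.encode b) s, b, by simp [hs]⟩
  refine ⟨fun a => (Nat.rfindOpt _).get (hdom a),
    (Partrec.rfindOpt hS).of_eq_tot fun a => Part.get_mem _, fun a => ?_⟩
  obtain ⟨s, hs⟩ := Nat.rfindOpt_spec (Part.get_mem (hdom a))
  rw [Option.mem_def, Option.bind_eq_some_iff] at hs
  obtain ⟨b, hb, hs⟩ := hs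
  cases hRs : R ((a, b), s.unpair.2) with
  | false => simp [hRs] at hs
  | true =>
    rw [hRs, cond_true, Option.some.injEq] at hs
    exact (hPR _).2 ⟨s.unpair.2, by simpa only [← hs] using hRs⟩

end Computability

/-! ### Codes for rational numbers -/

/-- The rational number `(a - b) / (d + 1)` coded by `(a, b, d)`. -/
noncomputable def ratValue (k : ℕ × ℕ × ℕ) : ℝ := ((k.1 : ℝ) - (k.2.1 : ℝ)) / ((k.2.2 : ℝ) + 1)

/-- A code for the difference of two coded rationals. -/
def ratSub (k l : ℕ × ℕ × ℕ) : ℕ × ℕ × ℕ :=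
  (k.1 * (l.2.2 + 1) + l.2.1 * (k.2.2 + 1), k.2.1 * (l.2.2 + 1) + l.1 * (k.2.2 + 1),
    k.2.2 * l.2.2 + k.2.2 + l.2.2)

/-- The order of coded rationals. -/
def ratLT (k l : ℕ × ℕ × ℕ) : Bool :=
  Nat.blt (k.1 * (l.2.2 + 1) + l.2.1 * (k.2.2 + 1)) (l.1 * (k.2.2 + 1) + k.2.1 * (l.2.2 + 1))

/-- A code for the left endpoint of a basic interval. -/
def leftEnd (k : ℕ × ℕ × ℕ) : ℕ × ℕ × ℕ := (k.1, 1, k.2.2)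

/-- A code for the right endpoint of a basic interval. -/
def rightEnd (k : ℕ × ℕ × ℕ) : ℕ × ℕ × ℕ := (k.2.1, 0, k.2.2)

section Codes

variable {ι : Type*} [Primcodable ι]

@[fun_prop]
theorem computable_ratSub {f g : ι → ℕ × ℕ × ℕ} (hf : Computable f) (hg : Computable g) :
    Computable fun a => ratSub (f a) (g a) := by
  unfold ratSub
  fun_prop

@[fun_prop]
theorem computable_ratLT {f g : ι → ℕ × ℕ × ℕ} (hf : Computable f) (hg : Computable g) :
    Computable fun a => ratLT (f a) (g a) := by
  unfold ratLT
  fun_prop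

@[fun_prop]
theorem computable_leftEnd {f : ι → ℕ × ℕ × ℕ} (hf : Computable f) :
    Computable fun a => leftEnd (f a) := by
  unfold leftEnd
  fun_prop

@[fun_prop]
theorem computable_rightEnd {f : ι → ℕ × ℕ × ℕ} (hf : Computable f) :
    Computable fun a => rightEnd (f a) := by
  unfold rightEnd
  fun_prop

end Codes

theorem ratValue_ratSub (k l : ℕ × ℕ × ℕ) : ratValue (ratSub k l) = ratValue k - ratValue l := by
  have h1 : (k.2.2 : ℝ) + 1 ≠ 0 := by positivity
  have h2 : (l.2.2 : ℝ) + 1 ≠ 0 := by positivity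
  have h3 : (k.2.2 : ℝ) * l.2.2 + k.2.2 + l.2.2 + 1 = (k.2.2 + 1) * (l.2.2 + 1) := by ring
  simp only [ratValue, ratSub]
  push_cast
  rw [h3]
  field_simp
  ring

theorem ratLT_iff {k l : ℕ × ℕ × ℕ} : ratLT k l = true ↔ ratValue k < ratValue l := by
  have h1 : 0 < (k.2.2 : ℝ) + 1 := by positivity
  have h2 : 0 < (l.2.2 : ℝ) + 1 := by positivity
  simp only [ratLT, Nat.blt_eq, ratValue]
  rw [div_lt_div_iff₀ h1 h2, ← Nat.cast_lt (α := ℝ)]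
  push_cast
  constructor <;> intro h <;> linarith

theorem not_ratLT_iff {k l : ℕ × ℕ × ℕ} : ratLT k l = false ↔ ratValue l ≤ ratValue k := by
  rw [← not_lt, ← ratLT_iff, Bool.not_eq_true]

theorem ratValue_leftEnd (k : ℕ × ℕ × ℕ) :
    ratValue (leftEnd k) = ((k.1 : ℝ) - 1) / ((k.2.2 : ℝ) + 1) := by
  simp [ratValue, leftEnd]

theorem ratValue_rightEnd (k : ℕ × ℕ × ℕ) :
    ratValue (rightEnd k) = (k.2.1 : ℝ) / ((k.2.2 : ℝ) + 1) := by
  simp [ratValue, rightEnd]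

theorem mem_intervalBasis {k : ℕ × ℕ × ℕ} {θ : unitInterval} :
    θ ∈ intervalBasis k ↔ ratValue (leftEnd k) < θ ∧ (θ : ℝ) < ratValue (rightEnd k) := by
  rw [ratValue_leftEnd, ratValue_rightEnd]
  rfl

theorem exists_ratValue_eq (q : ℚ) : ∃ k, ratValue k = q := by
  refine ⟨(q.num.toNat, (-q.num).toNat, q.den - 1), ?_⟩
  have h1 : ((q.den - 1 : ℕ) : ℝ) + 1 = q.den := by
    have := q.pos
    rw [← Nat.cast_succ]
    congr 1
    omega
  have h2 : ((q.num.toNat : ℕ) : ℝ) - ((-q.num).toNat : ℕ) = (q.num : ℝ) := by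
    have : ((q.num.toNat : ℤ)) - ((-q.num).toNat : ℤ) = q.num := by omega
    exact_mod_cast this
  simp only [ratValue, h1, h2]
  exact (Rat.cast_def q).symm

theorem exists_ratValue_btwn {x y : ℝ} (h : x < y) : ∃ k, x < ratValue k ∧ ratValue k < y := by
  obtain ⟨q, h1, h2⟩ := exists_rat_btwn h
  obtain ⟨k, hk⟩ := exists_ratValue_eq q
  exact ⟨k, by rwa [hk], by rwa [hk]⟩

/-- The basic intervals around a point are arbitrarily small. -/
theorem exists_intervalBasis_btwn {θ : unitInterval} {l u : ℝ} (hl : l < θ) (hu : (θ : ℝ) < u) :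
    ∃ k, θ ∈ intervalBasis k ∧ l < ratValue (leftEnd k) ∧ ratValue (rightEnd k) < u := by
  obtain ⟨d, hd⟩ := exists_nat_one_div_lt (lt_min (sub_pos.2 hl) (sub_pos.2 hu))
  have hd1 := hd.trans_le (min_le_left _ _)
  have hd2 := hd.trans_le (min_le_right _ _)
  have hpos : (0 : ℝ) < d + 1 := by positivity
  have hθ : 0 ≤ (θ : ℝ) * (d + 1) := mul_nonneg θ.2.1 hpos.le
  have ha1 := Nat.le_ceil ((θ : ℝ) * (d + 1))
  have ha2 := Nat.ceil_lt_add_one hθ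
  have hb1 := Nat.floor_le hθ
  have hb2 := Nat.lt_floor_add_one ((θ : ℝ) * (d + 1))
  refine ⟨(⌈(θ : ℝ) * (d + 1)⌉₊, ⌊(θ : ℝ) * (d + 1)⌋₊ + 1, d), ?_, ?_, ?_⟩
  · simp only [mem_intervalBasis, ratValue_leftEnd, ratValue_rightEnd]
    rw [div_lt_iff₀ hpos, lt_div_iff₀ hpos]
    push_cast
    constructor <;> linarith
  · rw [div_lt_iff₀ hpos] at hd1
    simp only [ratValue_leftEnd]
    rw [lt_div_iff₀ hpos]
    nlinarith
  · rw [div_lt_iff₀ hpos] at hd2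
    simp only [ratValue_rightEnd]
    rw [div_lt_iff₀ hpos]
    push_cast
    nlinarith

/-! ### C.e. open subsets of the unit interval and their measures -/

section Measures

variable {ι κ Y : Type*} [Primcodable ι] [Primcodable κ]

theorem uniformlyCEOpen_intervalBasis {U : ι → Set unitInterval} {W : ι × ℕ × ℕ × ℕ → Prop}
    (hW : REPred W) (hsub : ∀ i k, W (i, k) → intervalBasis k ⊆ U i)
    (hmem : ∀ i, ∀ θ ∈ U i, ∃ l u : ℝ, l < θ ∧ (θ : ℝ) < u ∧
      ∀ k, l < ratValue (leftEnd k) → ratValue (rightEnd k) < u → W (i, k)) :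
    UniformlyCEOpen intervalBasis U := by
  refine ⟨fun i k => W (i, k), hW, fun i => Set.Subset.antisymm (fun θ hθ => ?_) ?_⟩
  · obtain ⟨l, u, hl, hu, h⟩ := hmem i θ hθ
    obtain ⟨k, hk, h1, h2⟩ := exists_intervalBasis_btwn hl hu
    exact Set.mem_iUnion₂.2 ⟨k, h k h1 h2, hk⟩
  · exact Set.iUnion₂_subset fun k hk => hsub i k hk

theorem UniformlyCEOpen.comp {κ' : Type*} [Primcodable κ'] {B : κ → Set Y} {U : ι → Set Y}
    (hU : UniformlyCEOpen B U) {f : κ' → ι} (hf : Computable f) :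
    UniformlyCEOpen B fun i => U (f i) := by
  obtain ⟨W, hW, hU⟩ := hU
  exact ⟨fun i k => W (f i) k, hW.comp (f := fun q : κ' × κ => (f q.1, q.2)) (by fun_prop),
    fun i => hU (f i)⟩

variable [MeasurableSpace Y]

/-- Uniformity of a computable measure for sequences with arbitrary index types. -/
theorem IsComputableMeasure.uniformlyLeftCE {B : κ → Set Y} {ν : Measure Y}
    (hν : IsComputableMeasure B ν) {U : ι → Set Y} (hU : UniformlyCEOpen B U) :
    UniformlyLeftCE fun i => ν (U i) := by
  obtain ⟨W, hW, hUW⟩ := hU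
  have hR : REPred fun q : (ℕ × κ) × ι => Nat.beq (Encodable.encode q.2) q.1.1 = true ∧
      W q.2 q.1.2 :=
    (rePred_of_bool (computable_beq (Computable.encode.comp Computable.snd)
      (by fun_prop))).and (hW.comp (f := fun q : (ℕ × κ) × ι => (q.2, q.1.2)) (by fun_prop))
  have h := hν (fun n => ⋃ (k) (_ : ∃ i, Nat.beq (Encodable.encode i) n = true ∧ W i k), B k)
    ⟨_, hR.exists, fun n => rfl⟩
  refine (h.comp (f := fun q : ι × ℕ × ℕ => (Encodable.encode q.1, q.2))
    ((Computable.encode.comp Computable.fst).pair Computable.snd)).of_eq fun q => ?_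
  simp [hUW, Encodable.encode_inj, Nat.beq_eq]

end Measures

theorem natCast_div_lt_measure_iff {Y : Type*} [MeasurableSpace Y] {ν : Measure Y}
    [IsFiniteMeasure ν] {s : Set Y} {a d : ℕ} :
    (a : ℝ≥0∞) / ((d : ℝ≥0∞) + 1) < ν s ↔ (a : ℝ) / ((d : ℝ) + 1) < ν.real s := by
  rw [Measure.real, ← ENNReal.toReal_lt_toReal _ (measure_ne_top ν s)]
  · simp [ENNReal.toReal_div, ENNReal.toReal_add]
  · exact ENNReal.div_ne_top (by simp) (by simp)

/-! ### A computable cut whose rational translates are null -/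

/-- `g` decides the order between `α` and the coded rationals, none of which equals `α`. -/
structure IsCut (α : ℝ) (g : ℕ × ℕ × ℕ → Bool) : Prop where
  computable : Computable g
  lt : ∀ k, g k = true → α < ratValue k
  gt : ∀ k, g k = false → ratValue k < α

theorem IsCut.true_iff {α : ℝ} {g : ℕ × ℕ × ℕ → Bool} (h : IsCut α g) (k : ℕ × ℕ × ℕ) :
    g k = true ↔ α < ratValue k := by
  refine ⟨h.lt k, fun hk => ?_⟩
  by_contra hg
  exact (h.gt k (by simpa using hg)).not_gt hk

theorem IsCut.false_iff {α : ℝ} {g : ℕ × ℕ × ℕ → Bool} (h : IsCut α g) (k : ℕ × ℕ × ℕ) :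
    g k = false ↔ ratValue k < α := by
  refine ⟨h.gt k, fun hk => ?_⟩
  by_contra hg
  exact (h.lt k (by simpa using hg)).not_gt hk

theorem uniformlyCEOpen_compl_Icc :
    UniformlyCEOpen intervalBasis fun i : (ℕ × ℕ × ℕ) × (ℕ × ℕ × ℕ) × (ℕ × ℕ × ℕ) =>
      {θ : unitInterval | (θ : ℝ) - ratValue i.1 < ratValue i.2.1 ∨
        ratValue i.2.2 < (θ : ℝ) - ratValue i.1} := by
  refine uniformlyCEOpen_intervalBasis (W := fun q =>
    ((ratLT (ratSub (rightEnd q.2) q.1.1) q.1.2.1 ||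
      ratLT q.1.2.2 (ratSub (leftEnd q.2) q.1.1)) = true))
    (rePred_of_bool (by fun_prop)) ?_ ?_
  · rintro ⟨q, s, t⟩ k hk θ hθ
    rw [mem_intervalBasis] at hθ
    simp only [Bool.or_eq_true, ratLT_iff, ratValue_ratSub] at hk
    rcases hk with hk | hk
    · left; dsimp only; linarith
    · right; dsimp only; linarith
  · rintro ⟨q, s, t⟩ θ hθ
    simp only [Bool.or_eq_true, ratLT_iff, ratValue_ratSub]
    rcases hθ with hθ | hθ
    · refine ⟨θ - 1, ratValue s + ratValue q, by linarith, by dsimp only at hθ; linarith,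
        fun k _ hk => Or.inl (by linarith)⟩
    · refine ⟨ratValue t + ratValue q, θ + 1, by dsimp only at hθ; linarith, by linarith,
        fun k hk _ => Or.inr (by linarith)⟩

theorem exists_null_translate_mem_Ioo (p : Measure unitInterval) [IsProbabilityMeasure p]
    {l u : ℝ} (h : l < u) (q : ℝ) :
    ∃ x, l < x ∧ x < u ∧ x ≠ q ∧ p {θ | (θ : ℝ) = x + q} = 0 := by
  have hc : Set.Countable {t : ℝ | 0 < p {θ : unitInterval | (θ : ℝ) = t}} :=
    Measure.countable_meas_level_set_pos measurable_subtype_coe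
  have hc' : Set.Countable (((fun x => x + q) ⁻¹' {t : ℝ | 0 < p {θ : unitInterval | (θ : ℝ) = t}})
      ∪ {q}) := by
    refine Set.Countable.union (hc.preimage (add_left_injective q)) (Set.countable_singleton q)
  obtain ⟨x, hx, hxl, hxu⟩ := (hc'.dense_compl ℝ).exists_between h
  simp only [Set.mem_compl_iff, Set.mem_union, not_or, Set.mem_preimage, Set.mem_ofPred_eq,
    Set.mem_singleton_iff, not_lt, nonpos_iff_eq_zero] at hx
  exact ⟨x, hxl, hxu, hx.2, hx.1⟩

theorem exists_small_closed_interval (p : Measure unitInterval) [IsProbabilityMeasure p]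
    {l u : ℝ} (h : l < u) (q : ℝ) (m : ℕ) :
    ∃ s t : ℕ × ℕ × ℕ, l ≤ ratValue s ∧ ratValue s < ratValue t ∧ ratValue t ≤ u ∧
      (ratValue t < q ∨ q < ratValue s) ∧
      (m : ℝ) / ((m : ℝ) + 1) <
        p.real {θ : unitInterval | (θ : ℝ) - q < ratValue s ∨ ratValue t < (θ : ℝ) - q} := by
  obtain ⟨x, hlx, hxu, hxq, hx⟩ := exists_null_translate_mem_Ioo p h q
  have hlim : Tendsto (fun n : ℕ => p {θ : unitInterval | |(θ : ℝ) - (x + q)| ≤ 1 / ((n : ℝ) + 1)})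
      atTop (𝓝 (p (⋂ n : ℕ, {θ : unitInterval | |(θ : ℝ) - (x + q)| ≤ 1 / ((n : ℝ) + 1)}))) := by
    refine tendsto_measure_iInter_atTop (fun n => ?_) (fun a b hab θ hθ => ?_)
      ⟨0, measure_ne_top _ _⟩
    · exact (measurableSet_le (by fun_prop) measurable_const).nullMeasurableSet
    · exact le_trans (Set.mem_ofPred_eq ▸ hθ :) (Nat.one_div_le_one_div hab)
  have hinter : (⋂ n : ℕ, {θ : unitInterval | |(θ : ℝ) - (x + q)| ≤ 1 / ((n : ℝ) + 1)}) =
      {θ : unitInterval | (θ : ℝ) = x + q} := by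
    ext θ
    simp only [Set.mem_iInter, Set.mem_ofPred_eq]
    constructor
    · intro hθ
      have : |(θ : ℝ) - (x + q)| ≤ 0 :=
        ge_of_tendsto' tendsto_one_div_add_atTop_nhds_zero_nat hθ
      linarith [abs_eq_zero.1 (le_antisymm this (abs_nonneg _))]
    · intro hθ n
      rw [hθ, sub_self, abs_zero]
      positivity
  rw [hinter, hx] at hlim
  have hpos : (0 : ℝ≥0∞) < ENNReal.ofReal (1 / ((m : ℝ) + 1)) := by
    rw [ENNReal.ofReal_pos]
    positivity
  obtain ⟨n, hn⟩ := (hlim.eventually (gt_mem_nhds hpos)).exists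
  have hη : (0 : ℝ) < 1 / ((n : ℝ) + 1) := by positivity
  have hst : ∃ s t : ℕ × ℕ × ℕ, l < ratValue s ∧ x - 1 / ((n : ℝ) + 1) < ratValue s ∧
      ratValue s < x ∧ x < ratValue t ∧ ratValue t < u ∧ ratValue t < x + 1 / ((n : ℝ) + 1) ∧
      (ratValue t < q ∨ q < ratValue s) := by
    rcases lt_or_gt_of_ne hxq with hxq | hxq
    · obtain ⟨s, hs1, hs2⟩ := exists_ratValue_btwn
        (show max l (x - 1 / ((n : ℝ) + 1)) < x from max_lt hlx (by linarith))
      obtain ⟨t, ht1, ht2⟩ := exists_ratValue_btwn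
        (show x < min (min u (x + 1 / ((n : ℝ) + 1))) q from
          lt_min (lt_min hxu (by linarith)) hxq)
      simp only [max_lt_iff, lt_min_iff] at hs1 ht2
      exact ⟨s, t, hs1.1, hs1.2, hs2, ht1, ht2.1.1, ht2.1.2, Or.inl ht2.2⟩
    · obtain ⟨s, hs1, hs2⟩ := exists_ratValue_btwn
        (show max (max l (x - 1 / ((n : ℝ) + 1))) q < x from
          max_lt (max_lt hlx (by linarith)) hxq)
      obtain ⟨t, ht1, ht2⟩ := exists_ratValue_btwn
        (show x < min u (x + 1 / ((n : ℝ) + 1)) from lt_min hxu (by linarith))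
      simp only [max_lt_iff, lt_min_iff] at hs1 ht2
      exact ⟨s, t, hs1.1.1, hs1.1.2, hs2, ht1, ht2.1, ht2.2, Or.inr hs1.2⟩
  obtain ⟨s, t, h1, h2, h3, h4, h5, h6, h7⟩ := hst
  refine ⟨s, t, h1.le, h3.trans h4, h5.le, h7, ?_⟩
  have hmeas : MeasurableSet {θ : unitInterval | (θ : ℝ) - q < ratValue s ∨
      ratValue t < (θ : ℝ) - q} :=
    (measurableSet_lt (measurable_subtype_coe.sub_const q) measurable_const).union
      (measurableSet_lt measurable_const (measurable_subtype_coe.sub_const q))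
  have hcompl : p.real {θ : unitInterval | (θ : ℝ) - q < ratValue s ∨
      ratValue t < (θ : ℝ) - q}ᶜ < 1 / ((m : ℝ) + 1) := by
    refine lt_of_le_of_lt (measureReal_mono (fun θ hθ => ?_)) ((ENNReal.lt_ofReal_iff_toReal_lt
      (measure_ne_top _ _)).1 hn)
    simp only [Set.mem_compl_iff, Set.mem_ofPred_eq, not_or, not_lt] at hθ
    rw [Set.mem_ofPred_eq, abs_le]
    constructor <;> linarith [hθ.1, hθ.2]
  rw [probReal_compl_eq_one_sub hmeas] at hcompl
  have : (m : ℝ) / ((m : ℝ) + 1) = 1 - 1 / ((m : ℝ) + 1) := by field_simp; ring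
  linarith

/-- One step of the construction of the cut. -/
theorem exists_cut_step {p : Measure unitInterval} [IsProbabilityMeasure p]
    (hp : IsComputableMeasure intervalBasis p) :
    ∃ f : ((ℕ × ℕ × ℕ) × ℕ) × (ℕ × ℕ × ℕ) × (ℕ × ℕ × ℕ) → (ℕ × ℕ × ℕ) × (ℕ × ℕ × ℕ),
      Computable f ∧ ∀ z, ratValue z.2.1 < ratValue z.2.2 →
        ratValue z.2.1 ≤ ratValue (f z).1 ∧ ratValue (f z).1 < ratValue (f z).2 ∧
        ratValue (f z).2 ≤ ratValue z.2.2 ∧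
        (ratValue (f z).2 < ratValue z.1.1 ∨ ratValue z.1.1 < ratValue (f z).1) ∧
        (z.1.2 : ℝ) / ((z.1.2 : ℝ) + 1) < p.real {θ : unitInterval |
          (θ : ℝ) - ratValue z.1.1 < ratValue (f z).1 ∨
          ratValue (f z).2 < (θ : ℝ) - ratValue z.1.1} := by
  have hce := hp.uniformlyLeftCE uniformlyCEOpen_compl_Icc
  have hR : REPred fun z : (((ℕ × ℕ × ℕ) × ℕ) × (ℕ × ℕ × ℕ) × (ℕ × ℕ × ℕ)) ×
      (ℕ × ℕ × ℕ) × (ℕ × ℕ × ℕ) => (!ratLT z.1.2.1 z.1.2.2) = true ∨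
      (((!ratLT z.2.1 z.1.2.1) && ratLT z.2.1 z.2.2 && (!ratLT z.1.2.2 z.2.2) &&
        (ratLT z.2.2 z.1.1.1 || ratLT z.1.1.1 z.2.1)) = true ∧
      ((z.1.1.2 : ℝ≥0∞) / ((z.1.1.2 : ℝ≥0∞) + 1) < p {θ : unitInterval |
        (θ : ℝ) - ratValue z.1.1.1 < ratValue z.2.1 ∨
        ratValue z.2.2 < (θ : ℝ) - ratValue z.1.1.1})) := by
    refine (rePred_of_bool (by fun_prop)).or ((rePred_of_bool (by fun_prop)).and ?_)
    exact hce.comp (f := fun z : (((ℕ × ℕ × ℕ) × ℕ) × (ℕ × ℕ × ℕ) × (ℕ × ℕ × ℕ)) ×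
      (ℕ × ℕ × ℕ) × (ℕ × ℕ × ℕ) => ((z.1.1.1, z.2.1, z.2.2), z.1.1.2, z.1.1.2)) (by fun_prop)
  obtain ⟨f, hf, hfR⟩ := hR.exists_choice fun ⟨⟨q, m⟩, s, t⟩ => by
    by_cases hst : ratValue s < ratValue t
    · obtain ⟨s', t', h1, h2, h3, h4, h5⟩ := exists_small_closed_interval p hst (ratValue q) m
      refine ⟨(s', t'), Or.inr ⟨?_, natCast_div_lt_measure_iff.2 h5⟩⟩
      simp [ratLT_iff, not_ratLT_iff, h1, h2, h3, h4]
    · exact ⟨(s, t), Or.inl (by simpa [not_ratLT_iff] using hst)⟩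
  refine ⟨f, hf, fun z hst => ?_⟩
  rcases hfR z with h | ⟨h, h'⟩
  · simp only [Bool.not_eq_eq_eq_not, Bool.not_true, not_ratLT_iff] at h
    exact absurd hst h.not_gt
  · simp only [Bool.and_eq_true, Bool.or_eq_true, Bool.not_eq_eq_eq_not, Bool.not_true,
      not_ratLT_iff, ratLT_iff] at h
    exact ⟨h.1.1.1, h.1.1.2, h.1.2, h.2, natCast_div_lt_measure_iff.1 h'⟩

/-- There is a computable irrational number all of whose rational translates are null. -/
theorem exists_cut {p : Measure unitInterval} [IsProbabilityMeasure p]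
    (hp : IsComputableMeasure intervalBasis p) :
    ∃ (α : ℝ) (g : ℕ × ℕ × ℕ → Bool), IsCut α g ∧ 0 < α ∧
      ∀ k, p {θ | (θ : ℝ) = α + ratValue k} = 0 := by
  obtain ⟨f, hf, hfs⟩ := exists_cut_step hp
  obtain ⟨I, hI, hI0, hIs⟩ : ∃ I : ℕ → (ℕ × ℕ × ℕ) × (ℕ × ℕ × ℕ), Computable I ∧
      I 0 = ((0, 0, 0), (1, 0, 0)) ∧
      ∀ n, I (n + 1) = f (Denumerable.ofNat ((ℕ × ℕ × ℕ) × ℕ) n, I n) := by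
    refine ⟨_, computable_rec (g := fun _ => ((0, 0, 0), (1, 0, 0)))
      (h := fun q : ℕ × ℕ × (ℕ × ℕ × ℕ) × (ℕ × ℕ × ℕ) =>
        f (Denumerable.ofNat ((ℕ × ℕ × ℕ) × ℕ) q.2.1, q.2.2))
      Computable.id (by fun_prop) ?_, rfl, fun n => rfl⟩
    exact hf.comp (((Computable.ofNat _).comp (by fun_prop)).pair (by fun_prop))
  have hlt : ∀ n, ratValue (I n).1 < ratValue (I n).2 := by
    intro n
    induction n with
    | zero => simp [hI0, ratValue]
    | succ n ih => rw [hIs]; exact (hfs (_, _) ih).2.1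
  have hmono : Monotone fun n => ratValue (I n).1 :=
    monotone_nat_of_le_succ fun n => by
      simpa only [hIs] using (hfs (_, I n) (hlt n)).1
  have hanti : Antitone fun n => ratValue (I n).2 :=
    antitone_nat_of_succ_le fun n => by
      simpa only [hIs] using (hfs (_, I n) (hlt n)).2.2.1
  have hmem := hmono.ciSup_mem_iInter_Icc_of_antitone hanti fun n => (hlt n).le
  set α := ⨆ n, ratValue (I n).1 with hα
  rw [Set.mem_iInter] at hmem
  have hstep : ∀ (k : ℕ × ℕ × ℕ) (m : ℕ), ∃ n,
      (ratValue (I n).2 < ratValue k ∨ ratValue k < ratValue (I n).1) ∧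
      (m : ℝ) / ((m : ℝ) + 1) < p.real {θ : unitInterval |
          (θ : ℝ) - ratValue k < ratValue (I n).1 ∨
          ratValue (I n).2 < (θ : ℝ) - ratValue k} ∧ n = Encodable.encode (k, m) + 1 := by
    intro k m
    have h := (hfs ((k, m), I (Encodable.encode (k, m))) (hlt _)).2.2.2
    have hn : I (Encodable.encode (k, m) + 1) = f ((k, m), I (Encodable.encode (k, m))) := by
      rw [hIs, Denumerable.ofNat_encode]
    exact ⟨_, by rw [hn]; exact h.1, by rw [hn]; exact h.2, rfl⟩
  obtain ⟨e, he, hes⟩ : ∃ e : ℕ × ℕ × ℕ → ℕ, Computable e ∧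
      ∀ k, ratValue (I (e k)).2 < ratValue k ∨ ratValue k < ratValue (I (e k)).1 := by
    refine ⟨fun k => Encodable.encode (k, 0) + 1, ?_, fun k => ?_⟩
    · have : Computable fun k : ℕ × ℕ × ℕ => Encodable.encode (k, 0) :=
        Computable.encode.comp (by fun_prop)
      fun_prop
    · obtain ⟨n, h, -, rfl⟩ := hstep k 0
      exact h
  have hcut : IsCut α fun k => ratLT (I (e k)).2 k := by
    refine ⟨by fun_prop, fun k hk => ?_, fun k hk => ?_⟩
    · exact (hmem _).2.trans_lt (ratLT_iff.1 hk)
    · exact ((hes k).resolve_left (not_lt.2 (not_ratLT_iff.1 hk))).trans_le (hmem _).1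
  refine ⟨α, _, hcut, ?_, fun k => ?_⟩
  · refine lt_of_le_of_ne ?_ fun h0 => ?_
    · simpa [hI0, ratValue] using (hmem 0).1
    · have h1 := hcut.lt (0, 0, 0)
      have h2 := hcut.gt (0, 0, 0)
      have h3 : ratValue (0, 0, 0) = 0 := by simp [ratValue]
      rw [h3, ← h0] at h1 h2
      cases hg : ratLT (I (e (0, 0, 0))).2 (0, 0, 0) with
      | true => exact lt_irrefl _ (h1 hg)
      | false => exact lt_irrefl _ (h2 hg)
  · have hle : ∀ m : ℕ, p.real {θ | (θ : ℝ) = α + ratValue k} ≤ 1 / ((m : ℝ) + 1) := by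
      intro m
      obtain ⟨n, -, h, -⟩ := hstep k m
      have hmeas : MeasurableSet {θ : unitInterval | (θ : ℝ) = α + ratValue k} :=
        measurableSet_eq_fun (by fun_prop) measurable_const
      have hsub : {θ : unitInterval | (θ : ℝ) - ratValue k < ratValue (I n).1 ∨
          ratValue (I n).2 < (θ : ℝ) - ratValue k} ⊆
          {θ : unitInterval | (θ : ℝ) = α + ratValue k}ᶜ := by
        intro θ hθ h'
        rw [Set.mem_ofPred_eq] at h'
        simp only [Set.mem_ofPred_eq, h', add_sub_cancel_right] at hθ
        rcases hθ with hθ | hθ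
        · exact absurd (hmem n).1 hθ.not_ge
        · exact absurd (hmem n).2 hθ.not_ge
      have := h.trans_le (measureReal_mono hsub)
      rw [probReal_compl_eq_one_sub hmeas] at this
      have h1 : (m : ℝ) / ((m : ℝ) + 1) = 1 - 1 / ((m : ℝ) + 1) := by field_simp; ring
      linarith
    have h0 : p.real {θ | (θ : ℝ) = α + ratValue k} ≤ 0 :=
      ge_of_tendsto' tendsto_one_div_add_atTop_nhds_zero_nat hle
    exact (measureReal_eq_zero_iff).1 (le_antisymm h0 measureReal_nonneg)

/-! ### Computable families of nonnegative reals -/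

/-- Uniform computability of a family of nonnegative reals, by approximations `a / (n + 1)`. -/
def ComputableFamily {ι : Type*} [Primcodable ι] (r : ι → ℝ) : Prop :=
  ∃ a : ι × ℕ → ℕ, Computable a ∧ ∀ i n, |r i - (a (i, n) : ℝ) / ((n : ℝ) + 1)| ≤ 1 / ((n : ℝ) + 1)

section ComputableFamily

variable {ι κ : Type*} [Primcodable ι] [Primcodable κ]

theorem computable_intCast {f : ι → ℕ} (hf : Computable f) : Computable fun i => (f i : ℤ) := by
  refine Computable.encode_iff.1 (Computable.of_eq (f := fun i => 2 * f i) (by fun_prop) fun i => ?_)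
  exact (congrFun Nat.bit_false _).symm

theorem ComputableFamily.uniformlyComputable {r : ι → ℝ} (hr : ComputableFamily r) :
    UniformlyComputable r := by
  obtain ⟨a, ha, hr⟩ := hr
  refine ⟨fun i n => (a (i, 2 ^ n - 1) : ℤ),
    computable_intCast (f := fun q : ι × ℕ => a (q.1, 2 ^ q.2 - 1)) (by fun_prop), fun i n => ?_⟩
  have h := hr i (2 ^ n - 1)
  have h2 : ((2 ^ n - 1 : ℕ) : ℝ) + 1 = 2 ^ n := by
    rw [Nat.cast_sub Nat.one_le_two_pow]
    push_cast
    ring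
  rw [h2] at h
  simpa only [Int.cast_natCast] using h

theorem ComputableFamily.comp {r : ι → ℝ} (hr : ComputableFamily r) {f : κ → ι}
    (hf : Computable f) : ComputableFamily fun k => r (f k) := by
  obtain ⟨a, ha, hr⟩ := hr
  exact ⟨fun q => a (f q.1, q.2), by fun_prop, fun k n => hr (f k) n⟩

/-- Approximations by fractions with arbitrary denominators suffice. -/
theorem ComputableFamily.of_fraction {r : ι → ℝ} {a d : ι × ℕ → ℕ} (ha : Computable a)
    (hd : Computable d)
    (h : ∀ i n, |r i - (a (i, n) : ℝ) / ((d (i, n) : ℝ) + 1)| ≤ 1 / ((n : ℝ) + 1)) :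
    ComputableFamily r := by
  refine ⟨fun q => (2 * (q.2 + 1) * a (q.1, 2 * q.2 + 1) + (d (q.1, 2 * q.2 + 1) + 1)) /
    (2 * (d (q.1, 2 * q.2 + 1) + 1)), by fun_prop, fun i n => ?_⟩
  have hn := h i (2 * n + 1)
  dsimp only
  generalize a (i, 2 * n + 1) = x at hn ⊢
  generalize d (i, 2 * n + 1) = y at hn ⊢
  have hdm := Nat.div_add_mod (2 * (n + 1) * x + (y + 1)) (2 * (y + 1))
  have hlt := Nat.mod_lt (2 * (n + 1) * x + (y + 1)) (show 0 < 2 * (y + 1) by positivity)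
  generalize (2 * (n + 1) * x + (y + 1)) % (2 * (y + 1)) = z at hdm hlt
  generalize (2 * (n + 1) * x + (y + 1)) / (2 * (y + 1)) = w at hdm ⊢
  have hdm' : 2 * ((y : ℝ) + 1) * w + z = 2 * (n + 1) * x + (y + 1) := by exact_mod_cast hdm
  have hlt' : (z : ℝ) < 2 * (y + 1) := by exact_mod_cast hlt
  have hz : (0 : ℝ) ≤ z := z.cast_nonneg
  have hy : (0 : ℝ) < (y : ℝ) + 1 := by positivity
  have hn0 : (0 : ℝ) < (n : ℝ) + 1 := by positivity
  have hround : |(x : ℝ) / (y + 1) - w / (n + 1)| ≤ 1 / (2 * ((n : ℝ) + 1)) := by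
    rw [div_sub_div _ _ hy.ne' hn0.ne', abs_div, abs_of_pos (mul_pos hy hn0),
      div_le_div_iff₀ (mul_pos hy hn0) (by positivity), one_mul]
    have : |(x : ℝ) * (n + 1) - (y + 1) * w| ≤ (y + 1) / 2 := by
      rw [abs_le]
      constructor <;> linarith
    calc _ ≤ ((y : ℝ) + 1) / 2 * (2 * (n + 1)) := by gcongr
      _ = _ := by ring
  have hcast : ((2 * n + 1 : ℕ) : ℝ) + 1 = 2 * (n + 1) := by push_cast; ring
  rw [hcast] at hn
  calc |r i - w / ((n : ℝ) + 1)|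
      ≤ |r i - x / (y + 1)| + |(x : ℝ) / (y + 1) - w / (n + 1)| := abs_sub_le _ _ _
    _ ≤ 1 / (2 * ((n : ℝ) + 1)) + 1 / (2 * ((n : ℝ) + 1)) := add_le_add hn hround
    _ = 1 / ((n : ℝ) + 1) := by field_simp; norm_num

theorem ComputableFamily.sum {r : ι × ℕ → ℝ} (hr : ComputableFamily r) {N : ι → ℕ}
    (hN : Computable N) : ComputableFamily fun i => ∑ k ∈ Finset.range (N i), r (i, k) := by
  obtain ⟨a, ha, hr⟩ := hr
  refine ComputableFamily.of_fraction
    (a := fun q => ∑ k ∈ Finset.range (N q.1), a ((q.1, k), (N q.1 + 1) * (q.2 + 1) - 1))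
    (d := fun q => (N q.1 + 1) * (q.2 + 1) - 1) ?_ (by fun_prop) fun i n => ?_
  · exact computable_sum (f := fun z : (ι × ℕ) × ℕ =>
      a ((z.1.1, z.2), (N z.1.1 + 1) * (z.1.2 + 1) - 1)) (by fun_prop) (by fun_prop)
  · have h1 : (((N i + 1) * (n + 1) - 1 : ℕ) : ℝ) + 1 = (N i + 1) * (n + 1) := by
      rw [Nat.cast_sub (Nat.one_le_iff_ne_zero.2 (by positivity))]
      push_cast
      ring
    have hN0 : (0 : ℝ) < (N i : ℝ) + 1 := by positivity
    have hn0 : (0 : ℝ) < (n : ℝ) + 1 := by positivity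
    dsimp only
    push_cast
    rw [Finset.sum_div, ← Finset.sum_sub_distrib]
    calc _ ≤ ∑ k ∈ Finset.range (N i), 1 / (((N i : ℝ) + 1) * (n + 1)) := by
          refine (Finset.abs_sum_le_sum_abs _ _).trans (Finset.sum_le_sum fun k _ => ?_)
          have := hr (i, k) ((N i + 1) * (n + 1) - 1)
          rwa [h1] at this ⊢
      _ = N i / ((N i : ℝ) + 1) * (1 / (n + 1)) := by
          rw [Finset.sum_const, Finset.card_range, nsmul_eq_mul]
          field_simp
      _ ≤ 1 * (1 / (n + 1)) := by
          gcongr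
          rw [div_le_one hN0]
          linarith
      _ = _ := one_mul _

theorem ComputableFamily.fraction_mul {r : ι → ℝ} (hr : ComputableFamily r) {c d : ι → ℕ}
    (hc : Computable c) (hd : Computable d) (hcd : ∀ i, c i ≤ d i + 1) :
    ComputableFamily fun i => (c i : ℝ) / ((d i : ℝ) + 1) * r i := by
  obtain ⟨a, ha, hr⟩ := hr
  refine ComputableFamily.of_fraction (a := fun q => c q.1 * a q)
    (d := fun q => (d q.1 + 1) * (q.2 + 1) - 1) (by fun_prop) (by fun_prop) fun i n => ?_
  have h1 : (((d i + 1) * (n + 1) - 1 : ℕ) : ℝ) + 1 = (d i + 1) * (n + 1) := by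
    rw [Nat.cast_sub (Nat.one_le_iff_ne_zero.2 (by positivity))]
    push_cast
    ring
  have hd0 : (0 : ℝ) < (d i : ℝ) + 1 := by positivity
  have hle : (c i : ℝ) / ((d i : ℝ) + 1) ≤ 1 := by
    rw [div_le_one hd0]
    exact_mod_cast hcd i
  dsimp only
  rw [h1]
  push_cast
  rw [mul_div_mul_comm, ← mul_sub, abs_mul, abs_of_nonneg (by positivity)]
  calc _ ≤ 1 * (1 / ((n : ℝ) + 1)) := by
        gcongr
        exact hr i n
    _ = _ := one_mul _

theorem ComputableFamily.of_tendsto {s : ι × ℕ → ℝ} (hs : ComputableFamily s) {r : ι → ℝ}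
    (h : ∀ i t, |r i - s (i, t)| ≤ 1 / ((t : ℝ) + 1)) : ComputableFamily r := by
  obtain ⟨a, ha, hs⟩ := hs
  refine ComputableFamily.of_fraction (a := fun q => a ((q.1, 2 * q.2 + 1), 2 * q.2 + 1))
    (d := fun q => 2 * q.2 + 1) (by fun_prop) (by fun_prop) fun i n => ?_
  calc _ ≤ |r i - s (i, 2 * n + 1)| + |s (i, 2 * n + 1) -
        (a ((i, 2 * n + 1), 2 * n + 1) : ℝ) / (((2 * n + 1 : ℕ) : ℝ) + 1)| := abs_sub_le _ _ _
    _ ≤ 1 / (((2 * n + 1 : ℕ) : ℝ) + 1) + 1 / (((2 * n + 1 : ℕ) : ℝ) + 1) :=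
        add_le_add (h _ _) (hs _ _)
    _ = 1 / ((n : ℝ) + 1) := by
        push_cast
        field_simp
        ring

/-- If `U` and `V` have complementary left-c.e. measures then these are computable. -/
theorem computableFamily_measureReal {Y : Type*} [MeasurableSpace Y] {ν : Measure Y}
    [IsProbabilityMeasure ν] {U V : ι → Set Y} (hU : UniformlyLeftCE fun i => ν (U i))
    (hV : UniformlyLeftCE fun i => ν (V i)) (h : ∀ i, ν.real (U i) + ν.real (V i) = 1) :
    ComputableFamily fun i => ν.real (U i) := by
  have hR : REPred fun q : (ι × ℕ) × ℕ => (Nat.beq q.2 0 = true ∨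
      ((q.2 - 1 : ℕ) : ℝ≥0∞) / ((q.1.2 : ℝ≥0∞) + 1) < ν (U q.1.1)) ∧
      (Nat.blt q.1.2 q.2 = true ∨
      ((q.1.2 - q.2 : ℕ) : ℝ≥0∞) / ((q.1.2 : ℝ≥0∞) + 1) < ν (V q.1.1)) := by
    have h1 := hU.comp (f := fun q : (ι × ℕ) × ℕ => (q.1.1, q.2 - 1, q.1.2)) (by fun_prop)
    have h2 := hV.comp (f := fun q : (ι × ℕ) × ℕ => (q.1.1, q.1.2 - q.2, q.1.2)) (by fun_prop)
    have h3 := rePred_of_bool (b := fun q : (ι × ℕ) × ℕ => Nat.beq q.2 0) (by fun_prop)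
    have h4 := rePred_of_bool (b := fun q : (ι × ℕ) × ℕ => Nat.blt q.1.2 q.2) (by fun_prop)
    exact (h3.or h1).and (h4.or h2)
  obtain ⟨a, ha, haR⟩ := hR.exists_choice fun ⟨i, n⟩ => by
    have hn0 : (0 : ℝ) < (n : ℝ) + 1 := by positivity
    have h0 : 0 ≤ ν.real (U i) * (n + 1) := by positivity
    refine ⟨⌊ν.real (U i) * (n + 1)⌋₊, ?_, ?_⟩
    · simp only [natCast_div_lt_measure_iff, div_lt_iff₀ hn0, Nat.beq_eq]
      refine or_iff_not_imp_left.2 fun hne => ?_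
      have := Nat.floor_le h0
      rw [Nat.cast_sub (Nat.one_le_iff_ne_zero.2 hne)]
      push_cast
      linarith
    · simp only [natCast_div_lt_measure_iff, div_lt_iff₀ hn0, Nat.blt_eq]
      refine or_iff_not_imp_left.2 fun hle => ?_
      have := Nat.lt_floor_add_one (ν.real (U i) * (n + 1))
      rw [Nat.cast_sub (not_lt.1 hle)]
      have hv : ν.real (V i) = 1 - ν.real (U i) := by linarith [h i]
      rw [hv]
      linarith
  refine ⟨a, ha, fun i n => ?_⟩
  have hn0 : (0 : ℝ) < (n : ℝ) + 1 := by positivity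
  have hle : ν.real (U i) ≤ 1 := measureReal_le_one
  have h0 : 0 ≤ ν.real (U i) := measureReal_nonneg
  have hz := haR (i, n)
  simp only [natCast_div_lt_measure_iff, div_lt_iff₀ hn0, Nat.beq_eq, Nat.blt_eq] at hz
  generalize a (i, n) = w at hz ⊢
  have h1 : ν.real (U i) * (n + 1) ≥ w - 1 := by
    rcases hz.1 with hw | hw
    · rw [hw]
      push_cast
      nlinarith
    · have : (w : ℝ) ≤ (w - 1 : ℕ) + 1 := by
        have : w ≤ w - 1 + 1 := by omega
        exact_mod_cast this
      linarith
  have h2 : ν.real (U i) * (n + 1) ≤ w + 1 := by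
    rcases hz.2 with hw | hw
    · have : (n : ℝ) < w := by exact_mod_cast hw
      nlinarith
    · have : (n : ℝ) ≤ (n - w : ℕ) + w := by
        have : n ≤ n - w + w := by omega
        exact_mod_cast this
      have hv : ν.real (V i) = 1 - ν.real (U i) := by linarith [h i]
      rw [hv] at hw
      linarith
  rw [abs_le]
  constructor
  · rw [neg_le_sub_iff_le_add, ← sub_le_iff_le_add, ← sub_div, div_le_iff₀ hn0]
    exact h1
  · rw [sub_le_iff_le_add', ← add_div, le_div_iff₀ hn0]
    exact h2

end ComputableFamily

/-! ### Intervals whose endpoints are rational translates of a cut -/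

/-- The trace on `[0,1]` of the open interval between two rational translates of `α`. -/
def cutInterval (α : ℝ) (i : (ℕ × ℕ × ℕ) × (ℕ × ℕ × ℕ)) : Set unitInterval :=
  {θ | α + ratValue i.1 < θ ∧ (θ : ℝ) < α + ratValue i.2}

/-- The exterior of `cutInterval`. -/
def cutExterior (α : ℝ) (i : (ℕ × ℕ × ℕ) × (ℕ × ℕ × ℕ)) : Set unitInterval :=
  {θ | (θ : ℝ) < α + ratValue i.1 ∨ α + ratValue i.2 < θ}

theorem measurableSet_cutInterval (α : ℝ) (i : (ℕ × ℕ × ℕ) × (ℕ × ℕ × ℕ)) :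
    MeasurableSet (cutInterval α i) :=
  (measurableSet_lt measurable_const measurable_subtype_coe).inter
    (measurableSet_lt measurable_subtype_coe measurable_const)

theorem measurableSet_cutExterior (α : ℝ) (i : (ℕ × ℕ × ℕ) × (ℕ × ℕ × ℕ)) :
    MeasurableSet (cutExterior α i) :=
  (measurableSet_lt measurable_subtype_coe measurable_const).union
    (measurableSet_lt measurable_const measurable_subtype_coe)

theorem IsCut.uniformlyCEOpen_cutInterval {α : ℝ} {g : ℕ × ℕ × ℕ → Bool} (hg : IsCut α g) :
    UniformlyCEOpen intervalBasis (cutInterval α) := by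
  have hgc := hg.computable
  refine uniformlyCEOpen_intervalBasis (W := fun q => (g (ratSub (leftEnd q.2) q.1.1) &&
    !g (ratSub (rightEnd q.2) q.1.2)) = true) (rePred_of_bool (by fun_prop)) ?_ ?_
  · intro i k hk θ hθ
    rw [mem_intervalBasis] at hθ
    simp only [Bool.and_eq_true, hg.true_iff, Bool.not_eq_eq_eq_not, Bool.not_true, hg.false_iff,
      ratValue_ratSub] at hk
    constructor <;> linarith [hk.1, hk.2, hθ.1, hθ.2]
  · rintro i θ ⟨h1, h2⟩
    refine ⟨_, _, h1, h2, fun k hl hu => ?_⟩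
    simp only [Bool.and_eq_true, hg.true_iff, Bool.not_eq_eq_eq_not, Bool.not_true, hg.false_iff,
      ratValue_ratSub]
    constructor <;> linarith

theorem IsCut.uniformlyCEOpen_cutExterior {α : ℝ} {g : ℕ × ℕ × ℕ → Bool} (hg : IsCut α g) :
    UniformlyCEOpen intervalBasis (cutExterior α) := by
  have hgc := hg.computable
  refine uniformlyCEOpen_intervalBasis (W := fun q => ((!g (ratSub (rightEnd q.2) q.1.1)) ||
    g (ratSub (leftEnd q.2) q.1.2)) = true) (rePred_of_bool (by fun_prop)) ?_ ?_
  · intro i k hk θ hθ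
    rw [mem_intervalBasis] at hθ
    simp only [Bool.or_eq_true, hg.true_iff, Bool.not_eq_eq_eq_not, Bool.not_true, hg.false_iff,
      ratValue_ratSub] at hk
    rcases hk with hk | hk
    · exact Or.inl (by linarith)
    · exact Or.inr (by linarith)
  · rintro i θ (h | h)
    · refine ⟨θ - 1, _, by linarith, h, fun k _ hu => ?_⟩
      simp only [Bool.or_eq_true, hg.true_iff, Bool.not_eq_eq_eq_not, Bool.not_true, hg.false_iff,
        ratValue_ratSub]
      left
      linarith
    · refine ⟨_, θ + 1, h, by linarith, fun k hl _ => ?_⟩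
      simp only [Bool.or_eq_true, hg.true_iff, Bool.not_eq_eq_eq_not, Bool.not_true, hg.false_iff,
        ratValue_ratSub]
      right
      linarith

theorem measure_compl_cutExterior {p : Measure unitInterval} {α : ℝ}
    (hα : ∀ k, p {θ | (θ : ℝ) = α + ratValue k} = 0) (i : (ℕ × ℕ × ℕ) × (ℕ × ℕ × ℕ)) :
    p (cutExterior α i)ᶜ = p (cutInterval α i) := by
  refine (measure_eq_measure_of_null_sdiff (fun θ hθ h => ?_) ?_).symm
  · rcases h with h | h
    · exact absurd hθ.1 h.not_gt
    · exact absurd hθ.2 h.not_gt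
  · refine measure_mono_null (fun θ hθ => ?_) (measure_union_null (hα i.1) (hα i.2))
    simp only [cutExterior, cutInterval, Set.mem_sdiff, Set.mem_compl_iff, Set.mem_ofPred_eq, not_or,
      not_lt, not_and] at hθ
    rcases hθ.1.1.eq_or_lt with h | h
    · exact Or.inl h.symm
    · exact Or.inr (le_antisymm hθ.1.2 (hθ.2 h))

theorem computableFamily_cutInterval {p : Measure unitInterval} [IsProbabilityMeasure p]
    (hp : IsComputableMeasure intervalBasis p) {α : ℝ} {g : ℕ × ℕ × ℕ → Bool} (hg : IsCut α g)
    (hα : ∀ k, p {θ | (θ : ℝ) = α + ratValue k} = 0) :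
    ComputableFamily fun i => p.real (cutInterval α i) := by
  refine computableFamily_measureReal (hp.uniformlyLeftCE hg.uniformlyCEOpen_cutInterval)
    (hp.uniformlyLeftCE hg.uniformlyCEOpen_cutExterior) fun i => ?_
  rw [Measure.real, ← measure_compl_cutExterior hα, ← Measure.real,
    probReal_compl_eq_one_sub (measurableSet_cutExterior α i)]
  ring

/-- The basis of intervals with endpoints that are rational translates of a cut. -/
def cutBasis (α : ℝ) (n : ℕ) : Set unitInterval :=
  cutInterval α (Denumerable.ofNat ((ℕ × ℕ × ℕ) × (ℕ × ℕ × ℕ)) n)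

theorem isComputableBasis_cutBasis {p : Measure unitInterval} [IsProbabilityMeasure p]
    (hp : IsComputableMeasure intervalBasis p) {α : ℝ} {g : ℕ × ℕ × ℕ → Bool} (hg : IsCut α g)
    (hα : ∀ k, p {θ | (θ : ℝ) = α + ratValue k} = 0) :
    IsComputableBasis intervalBasis p (cutBasis α) where
  ceOpen := hg.uniformlyCEOpen_cutInterval.comp (Computable.ofNat _)
  generates := by
    rintro V ⟨W, hW, hV⟩
    have hgc := hg.computable
    obtain ⟨e, he, heq⟩ : ∃ e : ℕ → (ℕ × ℕ × ℕ) × (ℕ × ℕ × ℕ), Computable e ∧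
        ∀ i, ∃ n, e n = i ∧ ∀ m, cutBasis α m = cutInterval α (e m) :=
      ⟨_, Computable.ofNat _, fun i => ⟨Encodable.encode i, Denumerable.ofNat_encode i,
        fun m => rfl⟩⟩
    have hR : REPred fun q : (ℕ × ℕ) × (ℕ × ℕ × ℕ) => W q.1.1 q.2 ∧
        ((!g (ratSub (leftEnd q.2) (e q.1.2).1)) && g (ratSub (rightEnd q.2) (e q.1.2).2)) = true :=
      (hW.comp (f := fun q : (ℕ × ℕ) × (ℕ × ℕ × ℕ) => (q.1.1, q.2)) (by fun_prop)).and
        (rePred_of_bool (by fun_prop))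
    refine ⟨fun m n => ∃ k, W m k ∧
      ((!g (ratSub (leftEnd k) (e n).1)) && g (ratSub (rightEnd k) (e n).2)) = true,
      hR.exists, fun m => Set.Subset.antisymm (fun θ hθ => ?_)
      (Set.iUnion₂_subset fun n ⟨k, hk, hgk⟩ θ hθ => ?_)⟩
    · rw [hV, Set.mem_iUnion₂] at hθ
      obtain ⟨k, hk, hθk⟩ := hθ
      rw [mem_intervalBasis] at hθk
      obtain ⟨q, hq1, hq2⟩ := exists_ratValue_btwn (sub_lt_sub_right hθk.1 α)
      obtain ⟨q', hq1', hq2'⟩ := exists_ratValue_btwn (sub_lt_sub_right hθk.2 α)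
      obtain ⟨n, hn, hbasis⟩ := heq (q, q')
      refine Set.mem_iUnion₂.2 ⟨n, ⟨k, hk, ?_⟩, ?_⟩
      · simp only [hn, Bool.and_eq_true, hg.true_iff, Bool.not_eq_eq_eq_not, Bool.not_true,
          hg.false_iff, ratValue_ratSub]
        constructor <;> linarith
      · rw [hbasis, hn]
        constructor <;> dsimp only <;> linarith
    · obtain ⟨-, -, hbasis⟩ := heq (e n)
      rw [hbasis] at hθ
      rw [hV, Set.mem_iUnion₂]
      refine ⟨k, hk, mem_intervalBasis.2 ?_⟩
      simp only [Bool.and_eq_true, hg.true_iff, Bool.not_eq_eq_eq_not, Bool.not_true,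
          hg.false_iff, ratValue_ratSub] at hgk
      constructor <;> linarith [hθ.1, hθ.2]
  computable := ((computableFamily_cutInterval hp hg hα).comp
    (Computable.ofNat _)).uniformlyComputable
  paired := by
    refine ⟨fun n => (cutExterior α (Denumerable.ofNat ((ℕ × ℕ × ℕ) × (ℕ × ℕ × ℕ)) n))ᶜ, ?_,
      fun n => ⟨fun θ hθ h => ?_, measure_compl_cutExterior hα _⟩⟩
    · unfold UniformlyEffClosed
      simp only [compl_compl]
      exact hg.uniformlyCEOpen_cutExterior.comp (Computable.ofNat _)
    · rcases h with h | h
      · exact absurd hθ.1 h.not_gt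
      · exact absurd hθ.2 h.not_gt

/-! ### Relative frequencies -/

theorem coe_relFreq (n : ℕ) (x : Cantor) :
    (relFreq n x : ℝ) = ratValue (bitCount x n, 0, n - 1) := by
  have h : (∑ i ∈ Finset.range n, if x i then (1 : ℝ) else 0) = bitCount x n := by
    rw [bitCount]
    push_cast
    refine Finset.sum_congr rfl fun i _ => ?_
    cases x i <;> simp
  simp only [relFreq, h, ratValue]
  rcases n with _ | n
  · simp [bitCount]
  · simp

theorem bitCount_congr {x y : ℕ → Bool} {n : ℕ} (h : ∀ i < n, x i = y i) :
    bitCount x n = bitCount y n :=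
  Finset.sum_congr rfl fun i hi => by rw [h i (Finset.mem_range.1 hi)]

theorem mem_cylinderBasis_iff {σ : List Bool} {x : Cantor} :
    x ∈ cylinderBasis σ ↔ ∀ i < σ.length, x i = σ.getD i false :=
  forall₂_congr fun i h => by rw [List.getD_eq_getElem _ _ h]

theorem mem_cylinderBasis_map_range (x : Cantor) (n : ℕ) :
    x ∈ cylinderBasis ((List.range n).map x) := by
  intro i h
  simp

@[fun_prop]
theorem computable_getD {α : Type*} [Primcodable α] {f : α → List Bool} {n : α → ℕ}
    (hf : Computable f) (hn : Computable n) : Computable fun a => (f a).getD (n a) false :=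
  (Primrec.list_getD false).to_comp.comp hf hn

section RelFreq

variable {ι : Type*} [Primcodable ι]

theorem uniformlyCEOpen_relFreq_preimage {S : ι → Set unitInterval} {P : ι × ℕ × ℕ × ℕ → Prop}
    (hP : REPred P) (h : ∀ i k (θ : unitInterval), (θ : ℝ) = ratValue k → (θ ∈ S i ↔ P (i, k))) :
    UniformlyCEOpen cylinderBasis fun q : ℕ × ι => relFreq q.1 ⁻¹' S q.2 := by
  have hR : REPred fun q : (ℕ × ι) × List Bool => Nat.beq q.2.length q.1.1 = true ∧
      P (q.1.2, bitCount (fun i => q.2.getD i false) q.1.1, 0, q.1.1 - 1) := by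
    have hc : Computable fun q : (ℕ × ι) × List Bool =>
        bitCount (fun i => q.2.getD i false) q.1.1 :=
      computable_bitCount (f := fun z : ((ℕ × ι) × List Bool) × ℕ => z.1.2.getD z.2 false)
        (by fun_prop) (by fun_prop)
    refine (rePred_of_bool (by fun_prop)).and (hP.comp ?_)
    fun_prop
  refine ⟨fun q σ => Nat.beq σ.length q.1 = true ∧
    P (q.2, bitCount (fun i => σ.getD i false) q.1, 0, q.1 - 1), hR, fun ⟨n, i⟩ => Set.Subset.antisymm (fun x hx => ?_)
    (Set.iUnion₂_subset fun σ ⟨hσ, hPσ⟩ x hx => ?_)⟩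
  · refine Set.mem_iUnion₂.2 ⟨(List.range n).map x, ⟨by simp, ?_⟩, mem_cylinderBasis_map_range x n⟩
    refine (h _ _ _ ?_).1 hx
    rw [coe_relFreq]
    congr 2
    exact bitCount_congr fun i hi => by simp [hi]
  · refine (h _ _ _ ?_).2 hPσ
    rw [coe_relFreq]
    congr 2
    simp only [Nat.beq_eq] at hσ
    rw [← hσ]
    exact bitCount_congr fun i hi => mem_cylinderBasis_iff.1 hx i hi

end RelFreq

theorem uniformlyComputableContinuous_relFreq :
    UniformlyComputableContinuous cylinderBasis intervalBasis relFreq := by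
  rintro V ⟨W, hW, hV⟩
  have hR : REPred fun q : (ℕ × ℕ × ℕ × ℕ) × (ℕ × ℕ × ℕ) => W q.1.1 q.2 ∧
      (ratLT (leftEnd q.2) q.1.2 && ratLT q.1.2 (rightEnd q.2)) = true :=
    (hW.comp (f := fun q : (ℕ × ℕ × ℕ × ℕ) × (ℕ × ℕ × ℕ) => (q.1.1, q.2)) (by fun_prop)).and
      (rePred_of_bool (by fun_prop))
  refine uniformlyCEOpen_relFreq_preimage hR.exists fun i k θ hθ => ?_
  simp only [hV, Set.mem_iUnion, exists_prop, mem_intervalBasis, hθ, ratLT_iff, Bool.and_eq_true]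

theorem IsCut.uniformlyCEOpen_relFreq_cutBasis {α : ℝ} {g : ℕ × ℕ × ℕ → Bool} (hg : IsCut α g) :
    UniformlyCEOpen cylinderBasis fun q : ℕ × ℕ => relFreq q.1 ⁻¹' cutBasis α q.2 := by
  have hgc := hg.computable
  have hc : UniformlyCEOpen cylinderBasis fun q : ℕ × (ℕ × ℕ × ℕ) × (ℕ × ℕ × ℕ) =>
      relFreq q.1 ⁻¹' cutInterval α q.2 := by
    refine uniformlyCEOpen_relFreq_preimage
      (P := fun q => (g (ratSub q.2 q.1.1) && !g (ratSub q.2 q.1.2)) = true)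
      (rePred_of_bool (by fun_prop)) fun i k θ hθ => ?_
    simp only [cutInterval, Set.mem_ofPred_eq, hθ, Bool.and_eq_true, hg.true_iff,
      Bool.not_eq_eq_eq_not, Bool.not_true, hg.false_iff, ratValue_ratSub, lt_sub_iff_add_lt,
      sub_lt_iff_lt_add]
  exact hc.comp (f := fun q : ℕ × ℕ => (q.1, Denumerable.ofNat _ q.2))
    (Computable.fst.pair ((Computable.ofNat _).comp Computable.snd))

theorem IsCut.uniformlyEffClosed_relFreq_cutBasis {α : ℝ} {g : ℕ × ℕ × ℕ → Bool}
    (hg : IsCut α g) :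
    UniformlyEffClosed cylinderBasis fun q : ℕ × ℕ => relFreq q.1 ⁻¹' cutBasis α q.2 := by
  have hgc := hg.computable
  have hc : UniformlyCEOpen cylinderBasis fun q : ℕ × (ℕ × ℕ × ℕ) × (ℕ × ℕ × ℕ) =>
      relFreq q.1 ⁻¹' (cutInterval α q.2)ᶜ := by
    refine uniformlyCEOpen_relFreq_preimage (S := fun i => (cutInterval α i)ᶜ)
      (P := fun q => (!(g (ratSub q.2 q.1.1) && !g (ratSub q.2 q.1.2))) = true)
      (rePred_of_bool (by fun_prop)) fun i k θ hθ => ?_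
    rw [Bool.not_eq_true', ← Bool.not_eq_true, Set.mem_compl_iff]
    simp only [cutInterval, Set.mem_ofPred_eq, hθ, Bool.and_eq_true, hg.true_iff,
      Bool.not_eq_eq_eq_not, Bool.not_true, hg.false_iff, ratValue_ratSub, lt_sub_iff_add_lt,
      sub_lt_iff_lt_add]
  exact hc.comp (f := fun q : ℕ × ℕ => (q.1, Denumerable.ofNat _ q.2))
    (Computable.fst.pair ((Computable.ofNat _).comp Computable.snd))

/-! ### The joint distribution and Chebyshev's inequality -/

theorem joint_eq_compProd (p : Measure unitInterval) [IsProbabilityMeasure p]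
    (C : Set unitInterval) (hC : MeasurableSet C) (hpC : p C = 1) :
    joint p C hC = p ⊗ₘ bernoulliKernel := by
  classical
  refine Measure.compProd_congr ?_
  have h : ∀ᵐ θ ∂p, θ ∈ C := by rwa [← prob_compl_eq_zero_iff hC] at hpC
  filter_upwards [h] with θ hθ
  rw [likelihood, Kernel.piecewise_apply, if_pos hθ]

/-- The `i`-th bit as a real random variable. -/
noncomputable def bitValue (i : ℕ) (x : Cantor) : ℝ := bif x i then 1 else 0

theorem measurable_bitValue (i : ℕ) : Measurable (bitValue i) :=
  (measurable_of_countable fun b : Bool => (bif b then (1 : ℝ) else 0)).comp (measurable_pi_apply i)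

theorem memLp_bitValue (θ : unitInterval) (i : ℕ) : MemLp (bitValue i) 2 (bernoulliProduct θ) := by
  refine MemLp.of_bound (measurable_bitValue i).aestronglyMeasurable 1 (ae_of_all _ fun x => ?_)
  unfold bitValue
  cases x i <;> simp

theorem integral_comp_eval (θ : unitInterval) (i : ℕ) (f : Bool → ℝ) :
    ∫ x, f (x i) ∂(bernoulliProduct θ) = θ * f true + (1 - θ) * f false := by
  have h : Measure.map (fun x : Cantor => x i) (bernoulliProduct θ) =
      bernoulliMeasure true false θ :=
    (measurePreserving_eval_infinitePi (fun _ : ℕ => bernoulliMeasure true false θ) i).map_eq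
  rw [← integral_map (μ := bernoulliProduct θ) (φ := fun x : Cantor => x i)
    (measurable_pi_apply i).aemeasurable (measurable_of_countable f).aestronglyMeasurable,
    h, integral_bernoulliMeasure]
  simp

theorem integral_bitValue (θ : unitInterval) (i : ℕ) :
    ∫ x, bitValue i x ∂(bernoulliProduct θ) = θ := by
  have := integral_comp_eval θ i fun b => bif b then 1 else 0
  simpa [bitValue] using this

theorem variance_bitValue (θ : unitInterval) (i : ℕ) :
    variance (bitValue i) (bernoulliProduct θ) = θ - (θ : ℝ) ^ 2 := by
  rw [variance_eq_sub (memLp_bitValue θ i), integral_bitValue]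
  have := integral_comp_eval θ i fun b => (bif b then 1 else 0) ^ 2
  simp only [Pi.pow_apply, bitValue, this]
  simp

theorem iIndepFun_bitValue (θ : unitInterval) :
    iIndepFun bitValue (bernoulliProduct θ) :=
  iIndepFun_infinitePi (P := fun _ : ℕ => bernoulliMeasure true false θ)
    (X := fun _ (b : Bool) => (bif b then (1 : ℝ) else 0)) fun _ => measurable_of_countable _

theorem coe_relFreq_eq_sum (n : ℕ) (x : Cantor) :
    (relFreq n x : ℝ) = (n : ℝ)⁻¹ * ∑ i ∈ Finset.range n, bitValue i x := by
  have h : ∀ i, (if x i then (1 : ℝ) else 0) = bitValue i x := fun i => by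
    unfold bitValue
    cases x i <;> simp
  simp only [relFreq, h]
  rw [div_eq_inv_mul]

theorem measurable_coe_relFreq (n : ℕ) : Measurable fun x => (relFreq n x : ℝ) := by
  simp only [coe_relFreq_eq_sum]
  exact (Finset.measurable_sum _ fun i _ => measurable_bitValue i).const_mul _

theorem bernoulliProduct_relFreq_le (θ : unitInterval) {n : ℕ} (hn : 0 < n) {ε : ℝ} (hε : 0 < ε) :
    bernoulliProduct θ {x | ε < |(relFreq n x : ℝ) - θ|} ≤
      ENNReal.ofReal (((θ : ℝ) - (θ : ℝ) ^ 2) / (ε ^ 2 * n)) := by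
  have hn' : (n : ℝ) ≠ 0 := by positivity
  let S : Cantor → ℝ := ∑ i ∈ Finset.range n, bitValue i
  have hfun : (fun x => (relFreq n x : ℝ)) = fun x => (n : ℝ)⁻¹ * S x :=
    funext fun x => by rw [coe_relFreq_eq_sum]; simp [S]
  have hS : MemLp S 2 (bernoulliProduct θ) := memLp_finsetSum' _ fun i _ => memLp_bitValue θ i
  have hmem : MemLp (fun x => (relFreq n x : ℝ)) 2 (bernoulliProduct θ) := by
    rw [hfun]
    exact hS.const_mul _
  have hint : ∫ x, (relFreq n x : ℝ) ∂(bernoulliProduct θ) = θ := by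
    simp only [coe_relFreq_eq_sum]
    rw [integral_const_mul, integral_finsetSum _ fun i _ =>
      (memLp_bitValue θ i).integrable one_le_two]
    simp only [integral_bitValue, Finset.sum_const, Finset.card_range, nsmul_eq_mul]
    field_simp
  have hvar : variance (fun x => (relFreq n x : ℝ)) (bernoulliProduct θ) =
      ((θ : ℝ) - (θ : ℝ) ^ 2) / n := by
    rw [hfun, variance_const_mul]
    have : variance S (bernoulliProduct θ) = ∑ i ∈ Finset.range n, _ :=
      IndepFun.variance_sum (fun i _ => memLp_bitValue θ i) fun i _ j _ hij =>
        (iIndepFun_bitValue θ).indepFun hij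
    rw [this]
    simp only [variance_bitValue, Finset.sum_const, Finset.card_range, nsmul_eq_mul]
    field_simp
  calc bernoulliProduct θ {x | ε < |(relFreq n x : ℝ) - θ|}
      ≤ bernoulliProduct θ {x | ε ≤ |(relFreq n x : ℝ) -
          ∫ x, (relFreq n x : ℝ) ∂(bernoulliProduct θ)|} := by
        rw [hint]
        exact measure_mono fun x (hx : ε < _) => hx.le
    _ ≤ ENNReal.ofReal (variance (fun x => (relFreq n x : ℝ)) (bernoulliProduct θ) / ε ^ 2) :=
        meas_ge_le_variance_div_sq hmem hε
    _ = _ := by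
        rw [hvar, div_div, mul_comm]

theorem measurableSet_deviation (n : ℕ) (ε : ℝ) :
    MeasurableSet {z : unitInterval × Cantor | ε < |(relFreq n z.2 : ℝ) - (z.1 : ℝ)|} := by
  refine measurableSet_lt measurable_const ?_
  exact (((measurable_coe_relFreq n).comp measurable_snd).sub
    (measurable_subtype_coe.comp measurable_fst)).abs

theorem compProd_deviation_le (p : Measure unitInterval) [IsProbabilityMeasure p] {n : ℕ}
    {ε : ℝ} (hn : 0 < n) (hε : 0 < ε) :
    (p ⊗ₘ bernoulliKernel).real {z | ε < |(relFreq n z.2 : ℝ) - (z.1 : ℝ)|} ≤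
      ((∫ θ : unitInterval, (θ : ℝ) ∂p) - ∫ θ : unitInterval, (θ : ℝ) ^ 2 ∂p) / (ε ^ 2 * n) := by
  have hi1 : Integrable (fun θ : unitInterval => (θ : ℝ)) p :=
    Integrable.of_bound measurable_subtype_coe.aestronglyMeasurable 1
      (ae_of_all _ fun θ => by rw [Real.norm_eq_abs, abs_of_nonneg θ.2.1]; exact θ.2.2)
  have hi2 : Integrable (fun θ : unitInterval => (θ : ℝ) ^ 2) p :=
    Integrable.of_bound (measurable_subtype_coe.pow_const 2).aestronglyMeasurable 1
      (ae_of_all _ fun θ => by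
        rw [Real.norm_eq_abs, abs_of_nonneg (by positivity)]
        exact pow_le_one₀ θ.2.1 θ.2.2)
  have hnn : ∀ θ : unitInterval, 0 ≤ ((θ : ℝ) - (θ : ℝ) ^ 2) / (ε ^ 2 * n) := fun θ =>
    div_nonneg (by nlinarith [θ.2.1, θ.2.2]) (by positivity)
  rw [← integral_sub hi1 hi2, ← integral_div]
  have hi3 : Integrable (fun θ : unitInterval => ((θ : ℝ) - (θ : ℝ) ^ 2) / (ε ^ 2 * n)) p :=
    (hi1.sub hi2).div_const _
  refine ENNReal.toReal_le_of_le_ofReal (integral_nonneg hnn) ?_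
  rw [ofReal_integral_eq_lintegral_ofReal hi3 (ae_of_all _ hnn),
    Measure.compProd_apply (measurableSet_deviation n ε)]
  exact lintegral_mono fun θ => bernoulliProduct_relFreq_le θ hn hε

/-- The mean of the relative frequencies along squares determines the limit. -/
theorem tendsto_relFreq_of_tendsto_sq {θ : unitInterval} {x : Cantor}
    (h : Tendsto (fun j => (relFreq (j ^ 2) x : ℝ)) atTop (𝓝 (θ : ℝ))) :
    Tendsto (fun n => relFreq n x) atTop (𝓝 θ) := by
  rw [tendsto_subtype_rng]
  have heq : ∀ n, (relFreq n x : ℝ) = (∑ i ∈ Finset.range n, bitValue i x) / n := fun n => by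
    rw [coe_relFreq_eq_sum, div_eq_inv_mul]
  simp only [heq] at h ⊢
  have hnn : ∀ i, 0 ≤ bitValue i x := fun i => by unfold bitValue; cases x i <;> simp
  refine tendsto_div_of_monotone_of_exists_subseq_tendsto_div
    (fun n => ∑ i ∈ Finset.range n, bitValue i x) θ ?_ fun a ha => ⟨fun j => j ^ 2, ?_, ?_, h⟩
  · exact fun m n hmn => Finset.sum_le_sum_of_subset_of_nonneg (Finset.range_mono hmn)
      fun i _ _ => hnn i
  · filter_upwards [(tendsto_natCast_atTop_atTop (R := ℝ)).eventually_ge_atTop (3 / (a - 1)),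
      eventually_ge_atTop 1] with n hn h1
    have ha0 : 0 < a - 1 := by linarith
    rw [div_le_iff₀ ha0] at hn
    have h1' : (1 : ℝ) ≤ n := by exact_mod_cast h1
    push_cast
    nlinarith
  · exact tendsto_pow_atTop two_ne_zero

/-! ### Probabilities of finite strings -/

/-- The probability of the string of the first `n` binary digits of `b`, for the parameter `θ`. -/
noncomputable def stringWeight (θ : ℝ) (n b : ℕ) : ℝ :=
  ∏ i ∈ Finset.range n, bif b.testBit i then θ else 1 - θ

theorem stringWeight_eq (θ : ℝ) (n b : ℕ) :
    stringWeight θ n b = θ ^ bitCount b.testBit n * (1 - θ) ^ bitCount (fun i => !b.testBit i) n := by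
  induction n with
  | zero => simp [stringWeight, bitCount]
  | succ n ih =>
    rw [stringWeight, Finset.prod_range_succ, ← stringWeight, ih]
    simp only [bitCount, Finset.sum_range_succ]
    cases b.testBit n
    · simp only [cond_false, Bool.not_false, cond_true, add_zero, pow_succ]
      ring
    · simp only [cond_false, Bool.not_true, cond_true, add_zero, pow_succ]
      ring

theorem bitCount_add_bitCount_not (x : ℕ → Bool) (n : ℕ) :
    bitCount x n + bitCount (fun i => !x i) n = n := by
  induction n with
  | zero => simp [bitCount]
  | succ n ih =>
    simp only [bitCount, Finset.sum_range_succ] at ih ⊢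
    cases x n <;> simp only [Bool.not_true, Bool.not_false, cond_true, cond_false] <;> omega

theorem abs_prod_sub_prod_le {n : ℕ} {a b : ℕ → ℝ} {c : ℝ} (ha : ∀ i, |a i| ≤ 1)
    (hb : ∀ i, |b i| ≤ 1) (h : ∀ i, |a i - b i| ≤ c) :
    |∏ i ∈ Finset.range n, a i - ∏ i ∈ Finset.range n, b i| ≤ n * c := by
  induction n with
  | zero => simp
  | succ n ih =>
    have h1 : |∏ i ∈ Finset.range n, b i| ≤ 1 := by
      rw [Finset.abs_prod]
      exact Finset.prod_le_one (fun i _ => abs_nonneg _) fun i _ => hb i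
    rw [Finset.prod_range_succ, Finset.prod_range_succ]
    calc _ = |(∏ i ∈ Finset.range n, a i - ∏ i ∈ Finset.range n, b i) * a n +
          (∏ i ∈ Finset.range n, b i) * (a n - b n)| := by ring_nf
      _ ≤ |∏ i ∈ Finset.range n, a i - ∏ i ∈ Finset.range n, b i| * |a n| +
          |∏ i ∈ Finset.range n, b i| * |a n - b n| := by
        rw [← abs_mul, ← abs_mul]
        exact abs_add_le _ _
      _ ≤ (n * c) * 1 + 1 * c := by
        have hc : 0 ≤ (n : ℝ) * c := (abs_nonneg _).trans ih
        gcongr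
        · exact ha n
        · exact h n
      _ = _ := by push_cast; ring

theorem abs_stringWeight_sub_le {θ q : ℝ} (hθ : θ ∈ Set.Icc (0 : ℝ) 1) (hq : q ∈ Set.Icc (0 : ℝ) 1)
    (n b : ℕ) : |stringWeight θ n b - stringWeight q n b| ≤ n * |θ - q| := by
  refine abs_prod_sub_prod_le (fun i => ?_) (fun i => ?_) fun i => ?_
  · cases b.testBit i <;> simp only [cond_true, cond_false] <;> rw [abs_le] <;>
      constructor <;> linarith [hθ.1, hθ.2]
  · cases b.testBit i <;> simp only [cond_true, cond_false] <;> rw [abs_le] <;>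
      constructor <;> linarith [hq.1, hq.2]
  · cases b.testBit i
    · simp only [cond_false]
      rw [show (1 - θ) - (1 - q) = -(θ - q) by ring, abs_neg]
    · simp

/-- The sequences whose first `n` bits are the binary digits of `b`. -/
def digitCylinder (n b : ℕ) : Set Cantor := {x | ∀ i < n, x i = b.testBit i}

theorem digitCylinder_eq_pi (n b : ℕ) :
    digitCylinder n b = Set.pi (Finset.range n) fun i => {b.testBit i} := by
  ext x
  simp [digitCylinder, Set.mem_pi]

theorem measurableSet_digitCylinder (n b : ℕ) : MeasurableSet (digitCylinder n b) := by
  rw [digitCylinder_eq_pi]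
  exact MeasurableSet.pi (Finset.countable_toSet _) fun i _ => measurableSet_singleton _

theorem bernoulliProduct_digitCylinder (θ : unitInterval) (n b : ℕ) :
    (bernoulliProduct θ).real (digitCylinder n b) = stringWeight θ n b := by
  rw [Measure.real, digitCylinder_eq_pi, bernoulliProduct,
    Measure.infinitePi_pi _ fun i _ => measurableSet_singleton _, ENNReal.toReal_prod]
  refine Finset.prod_congr rfl fun i _ => ?_
  rw [← Measure.real]
  classical
  rw [bernoulliMeasure_real_apply _ (measurableSet_singleton _)]
  cases b.testBit i <;> simp

theorem exists_mem_digitCylinder (x : Cantor) (n : ℕ) : ∃ b < 2 ^ n, x ∈ digitCylinder n b :=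
  ⟨Nat.ofBits fun i : Fin n => x i, Nat.ofBits_lt_two_pow _, fun i hi => by
    rw [Nat.testBit_ofBits_lt _ _ hi]⟩

theorem disjoint_digitCylinder {n b b' : ℕ} (hb : b < 2 ^ n) (hb' : b' < 2 ^ n) (h : b ≠ b') :
    Disjoint (digitCylinder n b) (digitCylinder n b') := by
  rw [Set.disjoint_left]
  refine fun x hx hx' => h (Nat.eq_of_testBit_eq fun i => ?_)
  by_cases hi : i < n
  · rw [← hx i hi, hx' i hi]
  · have : 2 ^ n ≤ 2 ^ i := Nat.pow_le_pow_right two_pos (not_lt.1 hi)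
    rw [Nat.testBit_lt_two_pow (hb.trans_le this), Nat.testBit_lt_two_pow (hb'.trans_le this)]

/-- The probability of a set of sequences that is decided by the first `n` bits. -/
theorem bernoulliProduct_eq_sum (θ : unitInterval) {n : ℕ} {G : ℕ → Bool} {E : Set Cantor}
    (h : ∀ b, ∀ x ∈ digitCylinder n b, (x ∈ E ↔ G b = true)) :
    (bernoulliProduct θ).real E =
      ∑ b ∈ Finset.range (2 ^ n), bif G b then stringWeight θ n b else 0 := by
  have hE : E = ⋃ b ∈ (Finset.range (2 ^ n)).filter (fun b => G b = true), digitCylinder n b := by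
    ext x
    simp only [Finset.mem_filter, Finset.mem_range, Set.mem_iUnion, exists_prop]
    constructor
    · intro hx
      obtain ⟨b, hb, hxb⟩ := exists_mem_digitCylinder x n
      exact ⟨b, ⟨hb, (h b x hxb).1 hx⟩, hxb⟩
    · rintro ⟨b, ⟨-, hG⟩, hxb⟩
      exact (h b x hxb).2 hG
  rw [hE, measureReal_biUnion_finset _ fun b _ => measurableSet_digitCylinder n b,
    Finset.sum_filter]
  · refine Finset.sum_congr rfl fun b _ => ?_
    rw [bernoulliProduct_digitCylinder]
    cases G b <;> simp
  · intro b hb b' hb' hne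
    simp only [Finset.coe_filter, Finset.mem_range, Set.mem_ofPred_eq] at hb hb'
    exact disjoint_digitCylinder hb.1 hb'.1 hne

/-! ### Cells of width `1 / (d + 1)` -/

/-- Codes for the endpoints, relative to the cut, of the `k`-th cell of width `1 / (d + 1)`, where
`e / (d + 1)` approximates the cut from below. -/
def cellCode (d e k : ℕ) : (ℕ × ℕ × ℕ) × (ℕ × ℕ × ℕ) := ((k, e + 1, d), (k, e, d))

theorem mem_cell_iff {α : ℝ} {d e k : ℕ} {θ : unitInterval} :
    θ ∈ cutInterval α (cellCode d e k) ↔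
      (k : ℝ) - (e + 1) < (θ - α) * (d + 1) ∧ (θ - α) * (d + 1) < k - e := by
  have hd : (0 : ℝ) < d + 1 := by positivity
  simp only [cutInterval, cellCode, Set.mem_ofPred_eq, ratValue]
  rw [← lt_sub_iff_add_lt', ← sub_lt_iff_lt_add', div_lt_iff₀ hd, lt_div_iff₀ hd]
  push_cast
  rfl

theorem eq_of_mem_cell {α : ℝ} {d e k l : ℕ} {θ : unitInterval}
    (hk : θ ∈ cutInterval α (cellCode d e k)) (hl : θ ∈ cutInterval α (cellCode d e l)) :
    k = l := by
  rw [mem_cell_iff] at hk hl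
  have h1 : (k : ℝ) < l + 1 := by linarith [hk.1, hl.2]
  have h2 : (l : ℝ) < k + 1 := by linarith [hl.1, hk.2]
  have h1' : k < l + 1 := by exact_mod_cast h1
  have h2' : l < k + 1 := by exact_mod_cast h2
  omega

theorem ae_exists_mem_cell {p : Measure unitInterval} {α : ℝ}
    (hα : ∀ k, p {θ | (θ : ℝ) = α + ratValue k} = 0) {d e : ℕ} (he : (e : ℝ) < α * (d + 1))
    (he' : α * (d + 1) < e + 1) :
    ∀ᵐ θ ∂p, ∃ k < d + 2, θ ∈ cutInterval α (cellCode d e k) := by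
  have hne : ∀ᵐ θ : unitInterval ∂p, ∀ k, (θ : ℝ) ≠ α + ratValue k :=
    ae_all_iff.2 fun k => by
      rw [ae_iff]
      simpa using hα k
  have hd : (0 : ℝ) < d + 1 := by positivity
  filter_upwards [hne] with θ hθ
  have h0 : 0 ≤ (θ - α) * (d + 1) + (e + 1) := by
    nlinarith [mul_nonneg θ.2.1 hd.le]
  have hfl := Nat.floor_le h0
  have hlf := Nat.lt_floor_add_one ((θ - α) * (d + 1) + (e + 1))
  refine ⟨⌊(θ - α) * (d + 1) + (e + 1)⌋₊, ?_, mem_cell_iff.2 ⟨?_, by linarith⟩⟩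
  · rw [Nat.floor_lt h0]
    push_cast
    nlinarith [mul_le_mul_of_nonneg_right θ.2.2 hd.le]
  · refine lt_of_le_of_ne (by linarith) fun h => ?_
    refine hθ (⌊(θ - α) * (d + 1) + (e + 1)⌋₊, e + 1, d) ?_
    rw [← sub_eq_iff_eq_add', ratValue, eq_div_iff hd.ne']
    push_cast
    exact h.symm

theorem abs_sub_le_of_mem_cell {α : ℝ} {d e k : ℕ} (he : (e : ℝ) < α * (d + 1))
    (he' : α * (d + 1) < e + 1) {θ : unitInterval} (h : θ ∈ cutInterval α (cellCode d e k)) :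
    |(θ : ℝ) - k / (d + 1)| ≤ 1 / ((d : ℝ) + 1) := by
  rw [mem_cell_iff] at h
  have hd : (0 : ℝ) < d + 1 := by positivity
  rw [abs_le]
  constructor
  · rw [neg_le_sub_iff_le_add, ← sub_le_iff_le_add, ← sub_div, div_le_iff₀ hd]
    nlinarith [h.1, h.2]
  · rw [sub_le_iff_le_add', ← add_div, le_div_iff₀ hd]
    nlinarith [h.1, h.2]

/-- The measure of a set that is decided by the cell of the parameter and the first `n` bits. -/
theorem abs_compProd_sub_sum_le {p : Measure unitInterval} [IsProbabilityMeasure p] {α : ℝ}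
    (hα : ∀ k, p {θ | (θ : ℝ) = α + ratValue k} = 0) {d e : ℕ} (he : (e : ℝ) < α * (d + 1))
    (he' : α * (d + 1) < e + 1) {n : ℕ} {G : ℕ → ℕ → Bool} {E : Set (unitInterval × Cantor)}
    (hE : MeasurableSet E)
    (h : ∀ k, ∀ θ ∈ cutInterval α (cellCode d e k), ∀ b, ∀ x ∈ digitCylinder n b,
      ((θ, x) ∈ E ↔ G k b = true)) :
    |(p ⊗ₘ bernoulliKernel).real E - ∑ k ∈ Finset.range (d + 2), ∑ b ∈ Finset.range (2 ^ n),
      (bif G k b then stringWeight (k / (d + 1)) n b else 0) *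
        p.real (cutInterval α (cellCode d e k))| ≤ n * 2 ^ n / (d + 1) := by
  have hd : (0 : ℝ) < d + 1 := by positivity
  let c : ℕ → ℝ := fun k => ∑ b ∈ Finset.range (2 ^ n),
    bif G k b then stringWeight (k / (d + 1)) n b else 0
  let f : unitInterval → ℝ := fun θ => (bernoulliProduct θ).real (Prod.mk θ ⁻¹' E)
  let s : unitInterval → ℝ := fun θ => ∑ k ∈ Finset.range (d + 2),
    (cutInterval α (cellCode d e k)).indicator (fun _ => c k) θ
  have hfm : Measurable f :=
    (Kernel.measurable_kernel_prodMk_left (κ := bernoulliKernel) hE).ennreal_toReal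
  have hf : Integrable f p := Integrable.of_bound hfm.aestronglyMeasurable 1
    (ae_of_all _ fun θ => by
      rw [Real.norm_eq_abs, abs_of_nonneg measureReal_nonneg]
      exact measureReal_le_one)
  have hs1 : ∀ k, Integrable ((cutInterval α (cellCode d e k)).indicator fun _ => c k) p :=
    fun k => (integrable_const _).indicator (measurableSet_cutInterval _ _)
  have hs : Integrable s p := integrable_finsetSum _ fun k _ => hs1 k
  have hfint : (p ⊗ₘ bernoulliKernel).real E = ∫ θ, f θ ∂p := by
    rw [Measure.real, Measure.compProd_apply hE]
    exact (integral_toReal (Kernel.measurable_kernel_prodMk_left hE).aemeasurable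
      (ae_of_all _ fun θ => measure_lt_top (bernoulliProduct θ) _)).symm
  have hsint : ∫ θ, s θ ∂p = ∑ k ∈ Finset.range (d + 2), ∑ b ∈ Finset.range (2 ^ n),
      (bif G k b then stringWeight (k / (d + 1)) n b else 0) *
        p.real (cutInterval α (cellCode d e k)) := by
    rw [integral_finsetSum _ fun k _ => hs1 k]
    refine Finset.sum_congr rfl fun k _ => ?_
    rw [integral_indicator_const _ (measurableSet_cutInterval _ _), smul_eq_mul, mul_comm,
      Finset.sum_mul]
  rw [hfint, ← hsint, ← integral_sub hf hs, ← Real.norm_eq_abs]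
  have hbound : ∀ᵐ θ ∂p, ‖f θ - s θ‖ ≤ n * 2 ^ n / (d + 1) := by
    filter_upwards [ae_exists_mem_cell hα he he'] with θ ⟨k, hk, hθ⟩
    have hsθ : s θ = c k := by
      rw [show s θ = _ from Finset.sum_eq_single_of_mem k (Finset.mem_range.2 hk)
        fun l _ hl => Set.indicator_of_notMem (fun hl' => hl (eq_of_mem_cell hl' hθ)) _,
        Set.indicator_of_mem hθ]
    have hfθ : f θ = ∑ b ∈ Finset.range (2 ^ n), bif G k b then stringWeight θ n b else 0 :=
      bernoulliProduct_eq_sum θ fun b x hx => h k θ hθ b x hx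
    have hq : (k : ℝ) / (d + 1) ∈ Set.Icc (0 : ℝ) 1 := by
      refine ⟨by positivity, (div_le_one hd).2 ?_⟩
      exact_mod_cast Nat.lt_succ_iff.1 hk
    rw [hsθ, hfθ, ← Finset.sum_sub_distrib, Real.norm_eq_abs]
    calc _ ≤ ∑ b ∈ Finset.range (2 ^ n), (n : ℝ) * (1 / (d + 1)) := by
          refine (Finset.abs_sum_le_sum_abs _ _).trans (Finset.sum_le_sum fun b _ => ?_)
          cases G k b
          · simp only [cond_false, sub_self, abs_zero]
            positivity
          · simp only [cond_true]
            refine (abs_stringWeight_sub_le θ.2 hq n b).trans ?_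
            gcongr
            exact abs_sub_le_of_mem_cell he he' hθ
      _ = _ := by
          rw [Finset.sum_const, Finset.card_range, nsmul_eq_mul]
          push_cast
          ring
  refine (norm_integral_le_of_norm_le_const hbound).trans ?_
  simp

/-! ### Deviations of the relative frequencies along the squares -/

/-- The parameter deviates from the relative frequency among the first `j ^ 2` bits; the thresholds
are rational translates of the cut `α`. -/
def deviationSet (α : ℝ) (u v : ℕ × ℕ × ℕ) (j : ℕ) : Set (unitInterval × Cantor) :=
  {z | (z.1 : ℝ) - relFreq (j ^ 2) z.2 < α - ratValue u ∨
    α - ratValue v < (z.1 : ℝ) - relFreq (j ^ 2) z.2}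

/-- There is a deviation at some `j` with `N < j < M`. -/
def blockSet (α : ℝ) (u v : ℕ × ℕ × ℕ) (N M : ℕ) : Set (unitInterval × Cantor) :=
  {z | ∃ j, N < j ∧ j < M ∧ z ∈ deviationSet α u v j}

/-- There is a deviation at some `j > N`. -/
def tailSet (α : ℝ) (u v : ℕ × ℕ × ℕ) (N : ℕ) : Set (unitInterval × Cantor) :=
  {z | ∃ j, N < j ∧ z ∈ deviationSet α u v j}

/-- The thresholds of the deviation sets have absolute values between `δ` and `2 δ`. -/
structure IsThreshold (α δ : ℝ) (u v : ℕ × ℕ × ℕ) : Prop where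
  lower_ge : -(2 * δ) ≤ α - ratValue u
  lower_le : α - ratValue u ≤ -δ
  upper_ge : δ ≤ α - ratValue v
  upper_le : α - ratValue v ≤ 2 * δ

theorem exists_isThreshold (α : ℝ) {δ : ℝ} (hδ : 0 < δ) : ∃ u v, IsThreshold α δ u v := by
  obtain ⟨u, hu1, hu2⟩ := exists_ratValue_btwn (show α + δ < α + 2 * δ by linarith)
  obtain ⟨v, hv1, hv2⟩ := exists_ratValue_btwn (show α - 2 * δ < α - δ by linarith)
  exact ⟨u, v, by linarith, by linarith, by linarith, by linarith⟩

theorem measurableSet_deviationSet (α : ℝ) (u v : ℕ × ℕ × ℕ) (j : ℕ) :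
    MeasurableSet (deviationSet α u v j) := by
  have h : Measurable fun z : unitInterval × Cantor => (z.1 : ℝ) - relFreq (j ^ 2) z.2 :=
    (measurable_subtype_coe.comp measurable_fst).sub
      ((measurable_coe_relFreq (j ^ 2)).comp measurable_snd)
  exact (measurableSet_lt h measurable_const).union (measurableSet_lt measurable_const h)

theorem blockSet_eq_biUnion (α : ℝ) (u v : ℕ × ℕ × ℕ) (N M : ℕ) :
    blockSet α u v N M = ⋃ j ∈ Finset.Ioo N M, deviationSet α u v j := by
  ext z
  simp [blockSet, and_assoc]

theorem tailSet_eq_iUnion (α : ℝ) (u v : ℕ × ℕ × ℕ) (N : ℕ) :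
    tailSet α u v N = ⋃ M, blockSet α u v N M := by
  ext z
  simp only [tailSet, blockSet, Set.mem_ofPred_eq, Set.mem_iUnion]
  exact ⟨fun ⟨j, h1, h2⟩ => ⟨j + 1, j, h1, j.lt_succ_self, h2⟩, fun ⟨_, j, h1, _, h2⟩ => ⟨j, h1, h2⟩⟩

theorem measurableSet_blockSet (α : ℝ) (u v : ℕ × ℕ × ℕ) (N M : ℕ) :
    MeasurableSet (blockSet α u v N M) := by
  rw [blockSet_eq_biUnion]
  exact Finset.measurableSet_biUnion _ fun j _ => measurableSet_deviationSet α u v j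

theorem measurableSet_tailSet (α : ℝ) (u v : ℕ × ℕ × ℕ) (N : ℕ) :
    MeasurableSet (tailSet α u v N) := by
  rw [tailSet_eq_iUnion]
  exact MeasurableSet.iUnion fun M => measurableSet_blockSet α u v N M

section Bounds

variable {p : Measure unitInterval} [IsProbabilityMeasure p] {α δ : ℝ} {u v : ℕ × ℕ × ℕ}

theorem measureReal_deviationSet_le (hδ : 0 < δ) (h : IsThreshold α δ u v) {j : ℕ} (hj : 0 < j) :
    (p ⊗ₘ bernoulliKernel).real (deviationSet α u v j) ≤ 1 / δ ^ 2 * ((j : ℝ) ^ 2)⁻¹ := by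
  have hsub : deviationSet α u v j ⊆
      {z | δ < |(relFreq (j ^ 2) z.2 : ℝ) - (z.1 : ℝ)|} := by
    rintro z (hz | hz) <;> rw [Set.mem_ofPred_eq, lt_abs]
    · exact Or.inl (by linarith [h.lower_le])
    · exact Or.inr (by linarith [h.upper_ge])
  refine (measureReal_mono hsub).trans ((compProd_deviation_le p (by positivity) hδ).trans ?_)
  have h1 : ∫ θ : unitInterval, (θ : ℝ) ∂p ≤ 1 := by
    refine (integral_mono_of_nonneg (ae_of_all _ fun θ => θ.2.1) (integrable_const 1)
      (ae_of_all _ fun θ => θ.2.2)).trans ?_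
    simp
  have h2 : 0 ≤ ∫ θ : unitInterval, (θ : ℝ) ^ 2 ∂p := integral_nonneg fun θ => by positivity
  rw [div_eq_mul_inv, mul_inv, ← mul_assoc]
  push_cast
  gcongr
  rw [one_div]
  exact mul_le_of_le_one_left (by positivity) (by linarith)

theorem measureReal_blockSet_le (hδ : 0 < δ) (h : IsThreshold α δ u v) {K : ℕ}
    (hK : 2 / δ ^ 2 ≤ K) (N M : ℕ) :
    (p ⊗ₘ bernoulliKernel).real (blockSet α u v N M) ≤ K / ((N : ℝ) + 1) := by
  rw [blockSet_eq_biUnion]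
  calc _ ≤ ∑ j ∈ Finset.Ioo N M, (p ⊗ₘ bernoulliKernel).real (deviationSet α u v j) :=
        measureReal_biUnion_finset_le _ _
    _ ≤ ∑ j ∈ Finset.Ioo N M, 1 / δ ^ 2 * ((j : ℝ) ^ 2)⁻¹ :=
        Finset.sum_le_sum fun j hj => measureReal_deviationSet_le hδ h
          ((Nat.zero_le N).trans_lt (Finset.mem_Ioo.1 hj).1)
    _ ≤ 1 / δ ^ 2 * (2 / ((N : ℝ) + 1)) := by
        rw [← Finset.mul_sum]
        gcongr
        exact sum_Ioo_inv_sq_le N M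
    _ = 2 / δ ^ 2 / ((N : ℝ) + 1) := by ring
    _ ≤ _ := by gcongr

theorem measureReal_tailSet_le (hδ : 0 < δ) (h : IsThreshold α δ u v) {K : ℕ}
    (hK : 2 / δ ^ 2 ≤ K) (N : ℕ) :
    (p ⊗ₘ bernoulliKernel).real (tailSet α u v N) ≤ K / ((N : ℝ) + 1) := by
  have hmono : Monotone (blockSet α u v N) := fun M M' hM z ⟨j, h1, h2, h3⟩ =>
    ⟨j, h1, h2.trans_le hM, h3⟩
  refine ENNReal.toReal_le_of_le_ofReal (by positivity) ?_
  rw [tailSet_eq_iUnion, hmono.measure_iUnion]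
  refine iSup_le fun M => ?_
  rw [ENNReal.le_ofReal_iff_toReal_le (measure_ne_top _ _) (by positivity)]
  exact measureReal_blockSet_le hδ h hK N M

theorem abs_measureReal_tailSet_sub_le (hδ : 0 < δ) (h : IsThreshold α δ u v) {K : ℕ}
    (hK : 2 / δ ^ 2 ≤ K) (N M : ℕ) :
    |(p ⊗ₘ bernoulliKernel).real (tailSet α u v N) -
      (p ⊗ₘ bernoulliKernel).real (blockSet α u v N (M + 1))| ≤ K / ((M : ℝ) + 1) := by
  have h1 : (p ⊗ₘ bernoulliKernel).real (blockSet α u v N (M + 1)) ≤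
      (p ⊗ₘ bernoulliKernel).real (tailSet α u v N) :=
    measureReal_mono fun z ⟨j, h1, _, h2⟩ => ⟨j, h1, h2⟩
  have h2 : (p ⊗ₘ bernoulliKernel).real (tailSet α u v N) ≤
      (p ⊗ₘ bernoulliKernel).real (blockSet α u v N (M + 1)) +
        (p ⊗ₘ bernoulliKernel).real (tailSet α u v M) := by
    refine (measureReal_mono (?_ : tailSet α u v N ⊆ blockSet α u v N (M + 1) ∪
      tailSet α u v M)).trans (measureReal_union_le _ _)
    rintro z ⟨j, h1, h2⟩
    by_cases hj : j < M + 1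
    · exact Or.inl ⟨j, h1, hj, h2⟩
    · exact Or.inr ⟨j, by omega, h2⟩
  rw [abs_of_nonneg (by linarith)]
  linarith [measureReal_tailSet_le (p := p) hδ h hK M]

end Bounds

/-! ### The tail sets are uniformly c.e. open -/

theorem IsCut.uniformlyCEOpen_tailSet {α : ℝ} {g : ℕ × ℕ × ℕ → Bool} (hg : IsCut α g)
    (u v : ℕ × ℕ × ℕ) : UniformlyCEOpen productBasis (tailSet α u v) := by
  have hgc := hg.computable
  let c : List Bool × ℕ → ℕ × ℕ × ℕ := fun q =>
    (bitCount (fun i => q.1.getD i false) (q.2 ^ 2), 0, q.2 ^ 2 - 1)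
  have hc : Computable c := by
    have : Computable fun q : List Bool × ℕ => bitCount (fun i => q.1.getD i false) (q.2 ^ 2) :=
      computable_bitCount (f := fun z : (List Bool × ℕ) × ℕ => z.1.1.getD z.2 false)
        (by fun_prop) (by fun_prop)
    fun_prop
  let b : (ℕ × (ℕ × ℕ × ℕ) × List Bool) × ℕ → Bool := fun q =>
    Nat.blt q.1.1 q.2 && Nat.beq q.1.2.2.length (q.2 ^ 2) &&
      ((!g (ratSub (rightEnd q.1.2.1) (ratSub (c (q.1.2.2, q.2)) u))) ||
        g (ratSub (leftEnd q.1.2.1) (ratSub (c (q.1.2.2, q.2)) v)))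
  have hb : Computable b := by fun_prop
  have hbt : ∀ N k σ j, b ((N, k, σ), j) = true ↔ N < j ∧ σ.length = j ^ 2 ∧
      (ratValue (rightEnd k) - ratValue (c (σ, j)) < α - ratValue u ∨
        α - ratValue v < ratValue (leftEnd k) - ratValue (c (σ, j))) := by
    intro N k σ j
    simp only [b, Bool.and_eq_true, Bool.or_eq_true, Nat.blt_eq, Nat.beq_eq, hg.true_iff,
      Bool.not_eq_eq_eq_not, Bool.not_true, hg.false_iff, ratValue_ratSub, and_assoc]
    refine and_congr_right fun _ => and_congr_right fun _ => or_congr ?_ ?_ <;>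
      constructor <;> intro h <;> linarith
  refine ⟨fun N k => ∃ j, b ((N, k), j) = true, rePred_of_exists_bool hb, fun N =>
    Set.Subset.antisymm ?_ (Set.iUnion₂_subset ?_)⟩
  · rintro ⟨θ, x⟩ ⟨j, hj, hz⟩
    have hf : ratValue (c ((List.range (j ^ 2)).map x, j)) = relFreq (j ^ 2) x := by
      rw [coe_relFreq]
      simp only [c]
      congr 2
      exact bitCount_congr fun i hi => by simp [hi]
    rw [Set.mem_iUnion₂]
    rcases hz with hz | hz
    · obtain ⟨k, hk, -, hk'⟩ := exists_intervalBasis_btwn (θ := θ) (l := θ - 1)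
        (u := α - ratValue u + relFreq (j ^ 2) x) (by linarith) (by dsimp only at hz; linarith)
      refine ⟨(k, (List.range (j ^ 2)).map x), ⟨j, ?_⟩, hk, mem_cylinderBasis_map_range x _⟩
      rw [hbt, hf]
      exact ⟨hj, by simp, Or.inl (by linarith)⟩
    · obtain ⟨k, hk, hk', -⟩ := exists_intervalBasis_btwn (θ := θ) (u := θ + 1)
        (l := α - ratValue v + relFreq (j ^ 2) x) (by dsimp only at hz; linarith) (by linarith)
      refine ⟨(k, (List.range (j ^ 2)).map x), ⟨j, ?_⟩, hk, mem_cylinderBasis_map_range x _⟩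
      rw [hbt, hf]
      exact ⟨hj, by simp, Or.inr (by linarith)⟩
  · rintro ⟨k, σ⟩ ⟨j, hj⟩ ⟨θ, x⟩ ⟨hθ, hx⟩
    rw [hbt] at hj
    obtain ⟨h1, h2, h3⟩ := hj
    have hf : ratValue (c (σ, j)) = relFreq (j ^ 2) x := by
      rw [coe_relFreq]
      simp only [c, ← h2]
      congr 2
      exact (bitCount_congr fun i hi => mem_cylinderBasis_iff.1 hx i hi).symm
    rw [mem_intervalBasis] at hθ
    rw [hf] at h3
    refine ⟨j, h1, ?_⟩
    rcases h3 with h3 | h3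
    · exact Or.inl (by dsimp only at hθ ⊢; linarith)
    · exact Or.inr (by dsimp only at hθ ⊢; linarith)

/-! ### The measures of the blocks are computable -/

/-- A code for the relative frequency of ones among the first `j ^ 2` binary digits of `b`. -/
def digitFreq (b j : ℕ) : ℕ × ℕ × ℕ := (bitCount b.testBit (j ^ 2), 0, j ^ 2 - 1)

/-- Decides the block set from the cell of the parameter and the binary digits of `b`. -/
def blockTest (u v : ℕ × ℕ × ℕ) (N M d e k b : ℕ) : Bool :=
  Nat.blt 0 (bitCount (fun j => Nat.blt N j &&
    ((!ratLT (ratSub (digitFreq b j) u) (k, e, d)) ||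
      !ratLT (k, e + 1, d) (ratSub (digitFreq b j) v))) M)

@[fun_prop]
theorem computable_testBit {ι : Type*} [Primcodable ι] {f g : ι → ℕ} (hf : Computable f)
    (hg : Computable g) : Computable fun a => (f a).testBit (g a) := by
  refine Computable.of_eq (f := fun a => Nat.beq (f a / 2 ^ g a % 2) 1) (by fun_prop) fun a => ?_
  rw [Nat.testBit_eq_decide_div_mod_eq, Bool.eq_iff_iff, decide_eq_true_eq, Nat.beq_eq]

@[fun_prop]
theorem computable_digitFreq {ι : Type*} [Primcodable ι] {f g : ι → ℕ} (hf : Computable f)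
    (hg : Computable g) : Computable fun a => digitFreq (f a) (g a) := by
  have : Computable fun a => bitCount (f a).testBit (g a ^ 2) :=
    computable_bitCount (f := fun z : ι × ℕ => (f z.1).testBit z.2) (by fun_prop) (by fun_prop)
  unfold digitFreq
  fun_prop

theorem computable_blockTest {ι : Type*} [Primcodable ι] (u v : ℕ × ℕ × ℕ)
    {N M d e k b : ι → ℕ} (hN : Computable N) (hM : Computable M) (hd : Computable d)
    (he : Computable e) (hk : Computable k) (hb : Computable b) :
    Computable fun a => blockTest u v (N a) (M a) (d a) (e a) (k a) (b a) := by
  have := computable_bitCount (f := fun z : ι × ℕ => Nat.blt (N z.1) z.2 &&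
    ((!ratLT (ratSub (digitFreq (b z.1) z.2) u) (k z.1, e z.1, d z.1)) ||
      !ratLT (k z.1, e z.1 + 1, d z.1) (ratSub (digitFreq (b z.1) z.2) v))) hM (by fun_prop)
  unfold blockTest
  fun_prop

theorem exists_int_eq_ratValue_mul {k l : ℕ × ℕ × ℕ} {d : ℕ} (hk : k.2.2 + 1 ∣ d + 1)
    (hl : l.2.2 + 1 ∣ d + 1) : ∃ A : ℤ, ratValue (ratSub k l) * ((d : ℝ) + 1) = A := by
  obtain ⟨x, hx⟩ := hk
  obtain ⟨y, hy⟩ := hl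
  have hx' : (d : ℝ) + 1 = (k.2.2 + 1) * x := by exact_mod_cast hx
  have hy' : (d : ℝ) + 1 = (l.2.2 + 1) * y := by exact_mod_cast hy
  refine ⟨((k.1 : ℤ) - k.2.1) * x - ((l.1 : ℤ) - l.2.1) * y, ?_⟩
  rw [ratValue_ratSub, sub_mul]
  nth_rw 1 [hx']
  rw [hy', ratValue, ratValue]
  push_cast
  field_simp

theorem mem_blockSet_iff_blockTest {α : ℝ} {u v : ℕ × ℕ × ℕ} {N M d e : ℕ}
    (hu : u.2.2 + 1 ∣ d + 1) (hv : v.2.2 + 1 ∣ d + 1)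
    (hj : ∀ j, 0 < j → j < M → j ^ 2 ∣ d + 1) {k : ℕ} {θ : unitInterval}
    (hθ : θ ∈ cutInterval α (cellCode d e k)) {b : ℕ} {x : Cantor}
    (hx : x ∈ digitCylinder (M ^ 2) b) :
    (θ, x) ∈ blockSet α u v N M ↔ blockTest u v N M d e k b = true := by
  rw [mem_cell_iff] at hθ
  have hd : (0 : ℝ) < d + 1 := by positivity
  simp only [blockSet, blockTest, Set.mem_ofPred_eq, Nat.blt_eq, bitCount_pos_iff, Bool.and_eq_true]
  refine exists_congr fun j => ?_
  rw [and_left_comm]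
  refine and_congr_right fun hjM => and_congr_right fun hNj => ?_
  have hj0 : 0 < j := (Nat.zero_le N).trans_lt hNj
  have hdiv : (digitFreq b j).2.2 + 1 ∣ d + 1 := by
    rw [digitFreq, Nat.sub_add_cancel (Nat.one_le_pow _ _ hj0)]
    exact hj j hj0 hjM
  have hfreq : (relFreq (j ^ 2) x : ℝ) = ratValue (digitFreq b j) := by
    rw [coe_relFreq, digitFreq, bitCount_congr fun i hi => hx i (hi.trans_le ?_)]
    exact Nat.pow_le_pow_left hjM.le 2
  obtain ⟨A, hA⟩ := exists_int_eq_ratValue_mul hdiv hu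
  obtain ⟨B, hB⟩ := exists_int_eq_ratValue_mul hdiv hv
  simp only [deviationSet, Set.mem_ofPred_eq, hfreq, Bool.or_eq_true, Bool.not_eq_eq_eq_not,
    Bool.not_true, not_ratLT_iff]
  refine or_congr ?_ ?_
  · have h1 : (θ : ℝ) - ratValue (digitFreq b j) < α - ratValue u ↔
        ((θ : ℝ) - α) * ((d : ℝ) + 1) < A := by
      rw [← hA, mul_lt_mul_iff_left₀ hd, ratValue_ratSub]
      constructor <;> intro h <;> linarith
    have h2 : ratValue (k, e, d) ≤ ratValue (ratSub (digitFreq b j) u) ↔ (k : ℝ) - e ≤ A := by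
      rw [← hA, ratValue, div_le_iff₀ hd]
    rw [h1, h2]
    constructor
    · intro h
      have : (k : ℝ) - (e + 1) < A := hθ.1.trans h
      have : (k : ℤ) - (e + 1) < A := by exact_mod_cast this
      have : (k : ℤ) - e ≤ A := by omega
      exact_mod_cast this
    · exact fun h => hθ.2.trans_le h
  · have h1 : α - ratValue v < (θ : ℝ) - ratValue (digitFreq b j) ↔
        B < ((θ : ℝ) - α) * ((d : ℝ) + 1) := by
      rw [← hB, mul_lt_mul_iff_left₀ hd, ratValue_ratSub]
      constructor <;> intro h <;> linarith
    have h2 : ratValue (ratSub (digitFreq b j) v) ≤ ratValue (k, e + 1, d) ↔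
        B ≤ (k : ℝ) - (e + 1) := by
      rw [← hB, ratValue.eq_def (k, e + 1, d), le_div_iff₀ hd]
      push_cast
      rfl
    rw [h1, h2]
    constructor
    · intro h
      have : (B : ℝ) < (k : ℝ) - e := h.trans hθ.2
      have : B < (k : ℤ) - e := by exact_mod_cast this
      have : B ≤ (k : ℤ) - (e + 1) := by omega
      exact_mod_cast this
    · exact fun h => lt_of_le_of_lt h hθ.1

/-- Computable lower approximations of a cut. -/
theorem IsCut.exists_floor {α : ℝ} {g : ℕ × ℕ × ℕ → Bool} (hg : IsCut α g) (hα : 0 < α) :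
    ∃ e : ℕ → ℕ, Computable e ∧ ∀ d, (e d : ℝ) < α * (d + 1) ∧ α * (d + 1) < e d + 1 := by
  have hgc := hg.computable
  have hR : REPred fun q : ℕ × ℕ => ((!g (q.2, 0, q.1)) && g (q.2 + 1, 0, q.1)) = true :=
    rePred_of_bool (by fun_prop)
  have hiff : ∀ d m : ℕ, ((!g (m, 0, d)) && g (m + 1, 0, d)) = true ↔
      (m : ℝ) < α * (d + 1) ∧ α * (d + 1) < m + 1 := by
    intro d m
    have hd : (0 : ℝ) < d + 1 := by positivity
    simp only [Bool.and_eq_true, Bool.not_eq_eq_eq_not, Bool.not_true, hg.false_iff, hg.true_iff,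
      ratValue]
    rw [div_lt_iff₀ hd, lt_div_iff₀ hd]
    push_cast
    simp
  obtain ⟨e, he, h⟩ := hR.exists_choice fun d => by
    have hd : (0 : ℝ) < d + 1 := by positivity
    have hfl := Nat.floor_le (mul_pos hα hd).le
    refine ⟨⌊α * (d + 1)⌋₊, (hiff _ _).2 ⟨lt_of_le_of_ne hfl fun heq => ?_,
      Nat.lt_floor_add_one _⟩⟩
    have hval : ratValue (⌊α * (d + 1)⌋₊, 0, d) = α := by
      rw [ratValue, div_eq_iff hd.ne']
      push_cast
      linarith
    cases hgv : g (⌊α * (d + 1)⌋₊, 0, d) with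
    | true => exact absurd (hg.lt _ hgv) (by rw [hval]; exact lt_irrefl _)
    | false => exact absurd (hg.gt _ hgv) (by rw [hval]; exact lt_irrefl _)
  exact ⟨e, he, fun d => (hiff _ _).1 (h d)⟩

theorem computableFamily_cell_sum {ι : Type*} [Primcodable ι] {p : Measure unitInterval}
    [IsProbabilityMeasure p] (hp : IsComputableMeasure intervalBasis p) {α : ℝ}
    {g : ℕ × ℕ × ℕ → Bool} (hg : IsCut α g) (hα : ∀ k, p {θ | (θ : ℝ) = α + ratValue k} = 0)
    {d e n : ι → ℕ} (hd : Computable d) (he : Computable e) (hn : Computable n)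
    {G : (ι × ℕ) × ℕ → Bool} (hG : Computable G) :
    ComputableFamily fun i => ∑ k ∈ Finset.range (d i + 2), ∑ b ∈ Finset.range (2 ^ n i),
      (bif G ((i, k), b) then stringWeight (k / (d i + 1)) (n i) b else 0) *
        p.real (cutInterval α (cellCode (d i) (e i) k)) := by
  let c : (ι × ℕ) × ℕ → ℕ := fun q => bif G q && Nat.blt q.1.2 (d q.1.1 + 2) then
    q.1.2 ^ bitCount q.2.testBit (n q.1.1) *
      (d q.1.1 + 1 - q.1.2) ^ bitCount (fun i => !q.2.testBit i) (n q.1.1) else 0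
  have hc : Computable c := by
    have h1 : Computable fun q : (ι × ℕ) × ℕ => bitCount q.2.testBit (n q.1.1) :=
      computable_bitCount (f := fun z : ((ι × ℕ) × ℕ) × ℕ => z.1.2.testBit z.2)
        (by fun_prop) (by fun_prop)
    have h2 : Computable fun q : (ι × ℕ) × ℕ => bitCount (fun i => !q.2.testBit i) (n q.1.1) :=
      computable_bitCount (f := fun z : ((ι × ℕ) × ℕ) × ℕ => !z.1.2.testBit z.2)
        (by fun_prop) (by fun_prop)
    fun_prop
  have hcell : ComputableFamily fun q : (ι × ℕ) × ℕ =>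
      p.real (cutInterval α (cellCode (d q.1.1) (e q.1.1) q.1.2)) := by
    refine (computableFamily_cutInterval hp hg hα).comp
      (f := fun q : (ι × ℕ) × ℕ => cellCode (d q.1.1) (e q.1.1) q.1.2) ?_
    unfold cellCode
    fun_prop
  have hpow : ∀ i, (d i + 1) ^ n i - 1 + 1 = (d i + 1) ^ n i := fun i =>
    Nat.sub_add_cancel (Nat.one_le_pow _ _ (Nat.succ_pos _))
  have hterm := hcell.fraction_mul hc (d := fun q => (d q.1.1 + 1) ^ n q.1.1 - 1) (by fun_prop) (by
    intro q
    rw [hpow]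
    cases hq : G q && Nat.blt q.1.2 (d q.1.1 + 2) with
    | false => simp [c, hq]
    | true =>
      simp only [c, hq, cond_true]
      have hk : q.1.2 ≤ d q.1.1 + 1 := by
        have := (Bool.and_eq_true _ _ ▸ hq).2
        rw [Nat.blt_eq] at this
        omega
      calc _ ≤ (d q.1.1 + 1) ^ bitCount q.2.testBit (n q.1.1) *
            (d q.1.1 + 1) ^ bitCount (fun i => !q.2.testBit i) (n q.1.1) := by
            gcongr
            omega
        _ = _ := by rw [← pow_add, bitCount_add_bitCount_not])
  have hsum := (hterm.sum (N := fun q : ι × ℕ => 2 ^ n q.1) (by fun_prop)).sum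
    (N := fun i => d i + 2) (by fun_prop)
  convert hsum using 2 with i
  refine Finset.sum_congr rfl fun k hk => Finset.sum_congr rfl fun b _ => ?_
  have hk' : Nat.blt k (d i + 2) = true := by
    rw [Nat.blt_eq]
    exact Finset.mem_range.1 hk
  have hkd : k ≤ d i + 1 := by
    have := Finset.mem_range.1 hk
    omega
  congr 1
  have hden : (((d i + 1) ^ n i - 1 : ℕ) : ℝ) + 1 = ((d i : ℝ) + 1) ^ n i := by
    exact_mod_cast congrArg (Nat.cast (R := ℝ)) (hpow i)
  rw [hden]
  simp only [c, hk', Bool.and_true]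
  cases G ((i, k), b) with
  | false => simp
  | true =>
    have hd0 : (d i : ℝ) + 1 ≠ 0 := by positivity
    simp only [cond_true]
    rw [stringWeight_eq]
    push_cast [Nat.cast_sub hkd]
    rw [one_sub_div hd0, div_pow, div_pow, div_mul_div_comm, ← pow_add, bitCount_add_bitCount_not]

theorem computableFamily_blockSet {p : Measure unitInterval} [IsProbabilityMeasure p]
    (hp : IsComputableMeasure intervalBasis p) {α : ℝ} {g : ℕ × ℕ × ℕ → Bool} (hg : IsCut α g)
    (hα0 : 0 < α) (hα : ∀ k, p {θ | (θ : ℝ) = α + ratValue k} = 0) (u v : ℕ × ℕ × ℕ) :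
    ComputableFamily fun q : ℕ × ℕ => (p ⊗ₘ bernoulliKernel).real (blockSet α u v q.1 q.2) := by
  obtain ⟨e, he, hed⟩ := hg.exists_floor hα0
  let D : (ℕ × ℕ) × ℕ → ℕ := fun i => i.1.2.factorial ^ 2 * (u.2.2 + 1) * (v.2.2 + 1) *
    (i.1.2 ^ 2 * 2 ^ i.1.2 ^ 2 + 1) * (i.2 + 1)
  have hD : Computable D := by
    have : Computable fun i : (ℕ × ℕ) × ℕ => i.1.2.factorial :=
      computable_factorial (by fun_prop)
    fun_prop
  have hD1 : ∀ i, D i - 1 + 1 = D i := fun i =>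
    Nat.sub_add_cancel (Nat.one_le_iff_ne_zero.2 (by
      have := Nat.factorial_pos i.1.2
      positivity))
  have hcomp := computableFamily_cell_sum hp hg hα (d := fun i => D i - 1)
    (e := fun i => e (D i - 1)) (n := fun i => i.1.2 ^ 2)
    (G := fun q => blockTest u v q.1.1.1.1 q.1.1.1.2 (D q.1.1 - 1) (e (D q.1.1 - 1)) q.1.2 q.2)
    (by fun_prop) (by fun_prop) (by fun_prop)
    (computable_blockTest u v (by fun_prop) (by fun_prop) (by fun_prop) (by fun_prop)
      (by fun_prop) (by fun_prop))
  refine hcomp.of_tendsto fun ⟨N, M⟩ t => ?_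
  refine (abs_compProd_sub_sum_le hα (hed _).1 (hed _).2 (measurableSet_blockSet α u v N M)
    fun k θ hθ b x hx => mem_blockSet_iff_blockTest ?_ ?_ ?_ hθ hx).trans ?_
  · rw [hD1]
    exact ⟨M.factorial ^ 2 * (v.2.2 + 1) * (M ^ 2 * 2 ^ M ^ 2 + 1) * (t + 1), by
      simp only [D]; ring⟩
  · rw [hD1]
    exact ⟨M.factorial ^ 2 * (u.2.2 + 1) * (M ^ 2 * 2 ^ M ^ 2 + 1) * (t + 1), by
      simp only [D]; ring⟩
  · intro j hj hjM
    rw [hD1]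
    refine (pow_dvd_pow_of_dvd (Nat.dvd_factorial hj hjM.le) 2).trans
      ⟨(u.2.2 + 1) * (v.2.2 + 1) * (M ^ 2 * 2 ^ M ^ 2 + 1) * (t + 1), ?_⟩
    simp only [D]
    ring
  · have hcast : ((D ((N, M), t) - 1 : ℕ) : ℝ) + 1 = D ((N, M), t) := by
      exact_mod_cast congrArg (Nat.cast (R := ℝ)) (hD1 ((N, M), t))
    have hpos : (0 : ℝ) < D ((N, M), t) := by
      rw [← hcast]
      positivity
    rw [hcast, div_le_div_iff₀ hpos (by positivity), one_mul]
    have hle : M ^ 2 * 2 ^ M ^ 2 * (t + 1) ≤ D ((N, M), t) := by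
      have h1 : 1 ≤ M.factorial ^ 2 * (u.2.2 + 1) * (v.2.2 + 1) :=
        Nat.one_le_iff_ne_zero.2 (by
          have := Nat.factorial_pos M
          positivity)
      calc M ^ 2 * 2 ^ M ^ 2 * (t + 1) ≤ 1 * (M ^ 2 * 2 ^ M ^ 2 + 1) * (t + 1) := by
            rw [one_mul]
            exact Nat.mul_le_mul_right _ (Nat.le_succ _)
        _ ≤ _ := by
            simp only [D]
            gcongr
    exact_mod_cast hle

theorem computableFamily_tailSet {p : Measure unitInterval} [IsProbabilityMeasure p]
    (hp : IsComputableMeasure intervalBasis p) {α : ℝ} {g : ℕ × ℕ × ℕ → Bool} (hg : IsCut α g)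
    (hα0 : 0 < α) (hα : ∀ k, p {θ | (θ : ℝ) = α + ratValue k} = 0) {δ : ℝ} (hδ : 0 < δ)
    {u v : ℕ × ℕ × ℕ} (h : IsThreshold α δ u v) :
    ComputableFamily fun N => (p ⊗ₘ bernoulliKernel).real (tailSet α u v N) := by
  obtain ⟨K, hK⟩ := exists_nat_ge (2 / δ ^ 2)
  have hb := (computableFamily_blockSet hp hg hα0 hα u v).comp
    (f := fun q : ℕ × ℕ => (q.1, K * (q.2 + 1) + 1)) (by fun_prop)
  refine hb.of_tendsto fun N t => (abs_measureReal_tailSet_sub_le hδ h hK N _).trans ?_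
  rw [div_le_div_iff₀ (by positivity) (by positivity)]
  push_cast
  linarith

/-! ### Random points -/

theorem countable_setOf_ceOpen {κ Y : Type*} [Primcodable κ] (B : κ → Set Y) :
    {U : Set Y | CEOpen B U}.Countable := by
  refine (Set.countable_range fun c : Nat.Partrec.Code =>
    ⋃ (k) (_ : (c.eval (Encodable.encode ((), k))).Dom), B k).mono ?_
  rintro U ⟨W, hW, hU⟩
  obtain ⟨c, hc⟩ := hW.exists_code
  refine ⟨c, ?_⟩
  rw [show U = _ from hU ()]
  simp only [← hc]

theorem exists_measurableSet_subset_kurtzRandom (p : Measure unitInterval)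
    [IsProbabilityMeasure p] :
    ∃ S ⊆ kurtzRandom intervalBasis p, MeasurableSet S ∧ ∀ᵐ θ ∂p, θ ∈ S := by
  let 𝒰 : Set (Set unitInterval) := {U | CEOpen intervalBasis U ∧ p U = 1}
  have hc : 𝒰.Countable := (countable_setOf_ceOpen intervalBasis).mono fun U hU => hU.1
  have hm : ∀ U ∈ 𝒰, MeasurableSet U := by
    rintro U ⟨⟨W, -, hU⟩, -⟩
    rw [show U = _ from hU ()]
    exact (isOpen_iUnion fun k => isOpen_iUnion fun _ => isOpen_intervalBasis k).measurableSet
  refine ⟨⋂₀ 𝒰, fun θ hθ U hU hpU => hθ U ⟨hU, hpU⟩, MeasurableSet.sInter hc hm, ?_⟩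
  have h : ∀ᵐ θ ∂p, ∀ U ∈ 𝒰, θ ∈ U := by
    refine (ae_ball_iff hc).2 fun U hU => ?_
    exact (prob_compl_eq_zero_iff (hm U hU)).2 hU.2
  filter_upwards [h] with θ hθ U hU using hθ U hU

theorem tendsto_relFreq_of_notMem_tailSet {α : ℝ} {z : unitInterval × Cantor}
    (h : ∀ l : ℕ, ∃ u v N, IsThreshold α (1 / ((l : ℝ) + 1)) u v ∧ z ∉ tailSet α u v N) :
    Tendsto (fun n => relFreq n z.2) atTop (𝓝 z.1) := by
  refine tendsto_relFreq_of_tendsto_sq (Metric.tendsto_atTop.2 fun ε hε => ?_)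
  obtain ⟨l, hl⟩ := exists_nat_one_div_lt (half_pos hε)
  obtain ⟨u, v, N, hT, hz⟩ := h l
  refine ⟨N + 1, fun j hj => ?_⟩
  have hzj : z ∉ deviationSet α u v j := fun hzj => hz ⟨j, by omega, hzj⟩
  simp only [deviationSet, Set.mem_ofPred_eq, not_or, not_lt] at hzj
  rw [Real.dist_eq, abs_lt]
  constructor <;> linarith [hzj.1, hzj.2, hT.lower_ge, hT.upper_le]

theorem exists_schnorrTest {p : Measure unitInterval} [IsProbabilityMeasure p] {α δ : ℝ}
    (hδ : 0 < δ) {u v : ℕ × ℕ × ℕ} (h : IsThreshold α δ u v) :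
    ∃ N : ℕ → ℕ, Computable N ∧
      ∀ m, (p ⊗ₘ bernoulliKernel) (tailSet α u v (N m)) ≤ (2⁻¹ : ℝ≥0∞) ^ m := by
  obtain ⟨K, hK⟩ := exists_nat_ge (2 / δ ^ 2)
  refine ⟨fun m => K * 2 ^ m, by fun_prop, fun m => ?_⟩
  have h1 := measureReal_tailSet_le (p := p) hδ h hK (K * 2 ^ m)
  have h2 : (K : ℝ) / (((K * 2 ^ m : ℕ) : ℝ) + 1) ≤ (2⁻¹ : ℝ) ^ m := by
    rw [div_le_iff₀ (by positivity), inv_pow]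
    push_cast
    have : (0 : ℝ) < 2 ^ m := by positivity
    field_simp
    linarith
  have h3 : (2⁻¹ : ℝ≥0∞) ^ m = ENNReal.ofReal ((2⁻¹ : ℝ) ^ m) := by
    rw [ENNReal.ofReal_pow (by norm_num), ENNReal.ofReal_inv_of_pos two_pos, ENNReal.ofReal_ofNat]
  rw [h3, ENNReal.le_ofReal_iff_toReal_le (measure_ne_top _ _) (by positivity)]
  exact h1.trans h2

theorem ae_tendsto_relFreq {p : Measure unitInterval} [IsProbabilityMeasure p] :
    ∃ D, MeasurableSet D ∧ (p ⊗ₘ bernoulliKernel) Dᶜ = 0 ∧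
      ∀ z ∈ D, Tendsto (fun n => relFreq n z.2) atTop (𝓝 z.1) := by
  have hpos : ∀ l : ℕ, 0 < 1 / ((l : ℝ) + 1) := fun l => by positivity
  choose u v hT using fun l : ℕ => exists_isThreshold 0 (hpos l)
  refine ⟨⋂ l, ⋃ N, (tailSet 0 (u l) (v l) N)ᶜ, MeasurableSet.iInter fun l =>
    MeasurableSet.iUnion fun N => (measurableSet_tailSet _ _ _ _).compl, ?_, fun z hz =>
    tendsto_relFreq_of_notMem_tailSet (α := 0) fun l => ?_⟩
  · rw [Set.compl_iInter]
    refine measure_iUnion_null fun l => ?_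
    rw [Set.compl_iUnion]
    simp only [compl_compl]
    obtain ⟨N, -, hN⟩ := exists_schnorrTest (p := p) (hpos l) (hT l)
    refine le_antisymm (ge_of_tendsto' (ENNReal.tendsto_pow_atTop_nhds_zero_of_lt_one
      (ENNReal.inv_lt_one.2 ENNReal.one_lt_two)) fun m => ?_) zero_le
    exact (measure_mono (Set.iInter_subset _ (N m))).trans (hN m)
  · obtain ⟨N, hN⟩ := Set.mem_iUnion.1 (Set.mem_iInter.1 hz l)
    exact ⟨u l, v l, N, hT l, hN⟩

theorem tendsto_relFreq_of_mem_schnorrRandom {p : Measure unitInterval} [IsProbabilityMeasure p]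
    (hp : IsComputableMeasure intervalBasis p) {α : ℝ} {g : ℕ × ℕ × ℕ → Bool} (hg : IsCut α g)
    (hα0 : 0 < α) (hα : ∀ k, p {θ | (θ : ℝ) = α + ratValue k} = 0) {z : unitInterval × Cantor}
    (hz : z ∈ schnorrRandom productBasis (p ⊗ₘ bernoulliKernel)) :
    Tendsto (fun n => relFreq n z.2) atTop (𝓝 z.1) := by
  refine tendsto_relFreq_of_notMem_tailSet (α := α) fun l => ?_
  have hpos : 0 < 1 / ((l : ℝ) + 1) := by positivity
  obtain ⟨u, v, hT⟩ := exists_isThreshold α hpos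
  obtain ⟨N, hNc, hN⟩ := exists_schnorrTest (p := p) hpos hT
  have h := hz (fun m => tailSet α u v (N m)) ((hg.uniformlyCEOpen_tailSet u v).comp hNc) hN
    (((computableFamily_tailSet hp hg hα0 hα hpos hT).comp hNc).uniformlyComputable)
  rw [Set.mem_iInter, not_forall] at h
  obtain ⟨m, hm⟩ := h
  exact ⟨u, v, N m, hT, hm⟩

end EffDoob

theorem mainTheorem6 (p : Measure unitInterval) [IsProbabilityMeasure p]
    (hp : IsComputableMeasure intervalBasis p)
    (C : Set unitInterval) (hC : EffClosed intervalBasis C) (hpC : p C = 1) :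
    -- the relative frequencies are uniformly computable continuous
    UniformlyComputableContinuous cylinderBasis intervalBasis
      relFreq ∧
    -- condition (1)
    (∃ D : Set (unitInterval × Cantor), MeasurableSet D ∧
      D ⊆ kurtzRandom intervalBasis p ×ˢ Set.univ ∧
      joint p C hC.measurableSet D = 1 ∧
      ∀ z ∈ D, Tendsto (fun n => relFreq n z.2) atTop (𝓝 z.1)) ∧
    -- condition (2)
    (∃ U : ℕ → Set unitInterval, IsComputableBasis intervalBasis p U ∧
      UniformlyCEOpen cylinderBasis
        (fun q : ℕ × ℕ => relFreq q.1 ⁻¹' U q.2) ∧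
      UniformlyEffClosed cylinderBasis
        (fun q : ℕ × ℕ => relFreq q.1 ⁻¹' U q.2)) ∧
    -- Chebyshev estimate
    (∀ (n : ℕ) (ε : ℝ), 0 < n → 0 < ε →
      (joint p C hC.measurableSet).real
          {z | ε < |(relFreq n z.2 : ℝ) - (z.1 : ℝ)|} ≤
        ((∫ θ : unitInterval, (θ : ℝ) ∂p) - ∫ θ : unitInterval, (θ : ℝ) ^ 2 ∂p) / (ε ^ 2 * n)) ∧
    -- strong law on the Schnorr random points
    (∀ z ∈ schnorrRandom productBasis (joint p C hC.measurableSet),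
      Tendsto (fun n => relFreq n z.2) atTop (𝓝 z.1)) := by
  obtain ⟨α, g, hg, hα0, hα⟩ := exists_cut hp
  rw [joint_eq_compProd p C hC.measurableSet hpC]
  refine ⟨uniformlyComputableContinuous_relFreq, ?_,
    ⟨cutBasis α, isComputableBasis_cutBasis hp hg hα, hg.uniformlyCEOpen_relFreq_cutBasis,
      hg.uniformlyEffClosed_relFreq_cutBasis⟩,
    fun n ε hn hε => compProd_deviation_le p hn hε,
    fun z hz => tendsto_relFreq_of_mem_schnorrRandom hp hg hα0 hα hz⟩
  obtain ⟨S, hSK, hSm, hS⟩ := exists_measurableSet_subset_kurtzRandom p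
  obtain ⟨D, hDm, hD0, hD⟩ := ae_tendsto_relFreq (p := p)
  refine ⟨(S ×ˢ Set.univ) ∩ D, (hSm.prod MeasurableSet.univ).inter hDm,
    fun z hz => ⟨hSK hz.1.1, Set.mem_univ _⟩, ?_, fun z hz => hD z hz.2⟩
  rw [← prob_compl_eq_zero_iff ((hSm.prod MeasurableSet.univ).inter hDm), Set.compl_inter]
  refine measure_union_null ?_ hD0
  have hcompl : ((S ×ˢ Set.univ)ᶜ : Set (unitInterval × Cantor)) = Sᶜ ×ˢ Set.univ := by
    ext z
    simp
  rw [hcompl, Measure.compProd_apply_prod hSm.compl MeasurableSet.univ]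
  simpa using show p Sᶜ = 0 from hS
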